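/- Let $T>0$, $n,m\ge 0$, and let $A,\bar A,Q,\bar Q,S:[0,T]\to\mathbb R^{n\times n}$, $B:[0,T]\to\mathbb R^{n\times m}$, $R:[0,T]\to\mathbb R^{m\times m}$ be bounded measurable deterministic functions and $\sigma\in L^2(0,T;\mathbb R^{n\times n})$, with $Q_t,\bar Q_t\ge 0$ symmetric, $R_t$ symmetric and $R_t\ge\delta I$ for some $\delta>0$. Let $\mu_0$ be a probability law on $\mathbb R^n$ with finite second moment. For $N\ge 2$ let $x_0^1,\dots,x_0^N$ be random vectors with law $\mu_0$ and $W^1,\dots,W^N$ be $n$-dimensional standard Wiener processes on a probability space $(\Omega,\mathcal F,\mathbb P)$, all mutually independent, and put $\mathcal F^i_t=\sigma(x_0^i,W^i_s,s\le t)$ and $\mathcal G_t=\sigma(x_0^j,W^j_s,\ s\le t,\ 1\le j\le N)$. Let $z:[0,T]\to\mathbb R^n$ be a continuous function that is the mean of an equilibrium of the mean field game, and for each $i$ let $u^i$ be the corresponding equilibrium strategy of player $i$ with trajectory $\hat y^i$. That is, $u^i\in L^2_{\mathcal F^i}(0,T;\mathbb R^m)$ (the square-integrable $\mathcal F^i$-adapted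 processes, adaptedness being understood up to null sets), $\hat y^i$ is the continuous solution of $$d\hat y^i_t=(A_t\hat y^i_t+B_tu^i_t+\bar A_tz_t)\,dt+\sigma_t\,dW^i_t,\qquad \hat y^i_0=x^i_0,$$ $\mathbb E[\hat y^i_t]=z_t$ for all $t\in[0,T]$, and $u^i$ minimizes over $v\in L^2_{\mathcal F^i}(0,T;\mathbb R^m)$ the cost $$J(v)=\tfrac12\,\mathbb E\Big[\int_0^T x_t^*Q_tx_t+v_t^*R_tv_t+(x_t-S_tz_t)^*\bar Q_t(x_t-S_tz_t)\,dt+x_T^*Q_Tx_T+(x_T-S_Tz_T)^*\bar Q_T(x_T-S_Tz_T)\Big],$$ where $dx_t=(A_tx_t+B_tv_t+\bar A_tz_t)\,dt+\sigma_t\,dW^i_t$, $x_0=x_0^i$. Let $(y^1,\dots,y^N)$ be the continuous $\mathcal G$-adapted solution (adapted up to null sets) of the $N$-player system driven by these strategies, $$dy^i_t=\Big(A_ty^i_t+B_tu^i_t+\bar A_t\,\frac1{N-1}\sum_{j\ne i}y^j_t\Big)dt+\sigma_t\,dW^i_t,\qquad y^i_0=x^i_0 .$$ Then, as $N\to\infty$,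 $$\sup_{1\le i\le N}\mathbb E\Big[\sup_{0\le t\le T}\|y^i_t-\hat y^i_t\|^2\Big]=O\Big(\frac1N\Big).$$ More precisely, there is a constant $C$ depending only on the coefficients, $T$, $\mu_0$ and $z$ (not on $N$ or the probability space) such that for every $N\ge2$ the left-hand side is at most $C/N$. -/

import Mathlib

open MeasureTheory ProbabilityTheory Filter Topology Set
open scoped NNReal ENNReal Matrix

namespace LQMFG

/-- `ℝᵈ` with its Euclidean norm. -/
abbrev Vec (d : ℕ) : Type := EuclideanSpace ℝ (Fin d)

/-- Matrix times vector, on Euclidean spaces. -/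
def mv {a b : ℕ} (M : Matrix (Fin a) (Fin b) ℝ) (x : Vec b) : Vec a :=
  WithLp.toLp 2 (M *ᵥ x.ofLp)

/-- The quadratic form `x* M x`. -/
noncomputable def quad {a : ℕ} (M : Matrix (Fin a) (Fin a) ℝ) (x : Vec a) : ℝ :=
  inner ℝ x (mv M x)

/-- A (Lebesgue-measurable) bounded deterministic matrix-valued function on `[0,T]`. -/
structure IsBoundedCoeff {a b : ℕ} (T : ℝ) (M : ℝ → Matrix (Fin a) (Fin b) ℝ) : Prop where
  measurable : ∀ i j, AEMeasurable (fun t => M t i j) (volume.restrict (Icc 0 T))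
  bounded : ∃ K : ℝ, ∀ t ∈ Icc 0 T, ∀ i j, |M t i j| ≤ K

/-- The data of the linear-quadratic game: horizon, coefficients of the dynamics and of the cost.
State and noise are `n`-dimensional, controls are `m`-dimensional. -/
structure Data (n m : ℕ) where
  T : ℝ
  A : ℝ → Matrix (Fin n) (Fin n) ℝ
  B : ℝ → Matrix (Fin n) (Fin m) ℝ
  Abar : ℝ → Matrix (Fin n) (Fin n) ℝ
  σ : ℝ → Matrix (Fin n) (Fin n) ℝ
  Q : ℝ → Matrix (Fin n) (Fin n) ℝ
  Qbar : ℝ → Matrix (Fin n) (Fin n) ℝ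
  S : ℝ → Matrix (Fin n) (Fin n) ℝ
  R : ℝ → Matrix (Fin m) (Fin m) ℝ
  δ : ℝ
  T_pos : 0 < T
  A_bdd : IsBoundedCoeff T A
  B_bdd : IsBoundedCoeff T B
  Abar_bdd : IsBoundedCoeff T Abar
  σ_memLp : ∀ i j, MemLp (fun t => σ t i j) 2 (volume.restrict (Icc 0 T))
  Q_bdd : IsBoundedCoeff T Q
  Qbar_bdd : IsBoundedCoeff T Qbar
  S_bdd : IsBoundedCoeff T S
  R_bdd : IsBoundedCoeff T R
  Q_nonneg : ∀ t ∈ Icc 0 T, (Q t).PosSemidef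
  Qbar_nonneg : ∀ t ∈ Icc 0 T, (Qbar t).PosSemidef
  δ_pos : 0 < δ
  R_ge : ∀ t ∈ Icc 0 T, (R t - δ • (1 : Matrix (Fin m) (Fin m) ℝ)).PosSemidef

/-- A `d`-dimensional standard Wiener process: the coordinates are independent real Brownian
motions. -/
structure IsWiener {d : ℕ} {Ω : Type*} [MeasurableSpace Ω] (P : Measure Ω)
    (W : ℝ≥0 → Ω → Vec d) : Prop where
  measurable : ∀ t, Measurable (W t)
  brownian : ∀ k : Fin d, IsBrownianReal (fun t ω => W t ω k) P
  indep : iIndepFun (fun (k : Fin d) (ω : Ω) (t : ℝ≥0) => W t ω k) P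

/-- A matrix-valued step function: the value is `val i` on `(τ i, τ (i+1)]`, and zero elsewhere. -/
structure StepFn (d : ℕ) where
  k : ℕ
  τ : Fin (k + 1) → ℝ≥0
  mono : Monotone τ
  val : Fin k → Matrix (Fin d) (Fin d) ℝ

/-- The step function as a function of time. -/
noncomputable def StepFn.toFun {d : ℕ} (φ : StepFn d) (s : ℝ) : Matrix (Fin d) (Fin d) ℝ :=
  ∑ i : Fin φ.k, (Ioc (φ.τ i.castSucc : ℝ) (φ.τ i.succ : ℝ)).indicator (fun _ => φ.val i) s

/-- The elementary integral `∫₀ᵗ φ dW`. -/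
noncomputable def StepFn.integral {d : ℕ} {Ω : Type*} (φ : StepFn d) (W : ℝ≥0 → Ω → Vec d)
    (t : ℝ) (ω : Ω) : Vec d :=
  ∑ i : Fin φ.k, mv (φ.val i)
    (W (min (φ.τ i.succ) t.toNNReal) ω - W (min (φ.τ i.castSucc) t.toNNReal) ω)

/-- `M` is a continuous version of the Wiener integral `t ↦ ∫₀ᵗ σ_s dW_s`, `t ∈ [0,T]`, of the
deterministic square-integrable integrand `σ`: each `M t` is the `L²(P)`-limit of the elementary
integrals of step functions that converge to `σ` in `L²(0,T)`. -/
structure IsWienerIntegral {d : ℕ} {Ω : Type*} [MeasurableSpace Ω] (P : Measure Ω) (T : ℝ)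
    (σ : ℝ → Matrix (Fin d) (Fin d) ℝ) (W : ℝ≥0 → Ω → Vec d) (M : ℝ → Ω → Vec d) : Prop where
  measurable : ∀ t ∈ Icc 0 T, AEStronglyMeasurable (M t) P
  continuous : ∀ᵐ ω ∂P, ContinuousOn (fun t => M t ω) (Icc 0 T)
  limit : ∃ φ : ℕ → StepFn d,
    (∀ i j, Tendsto (fun k => eLpNorm (fun s => σ s i j - (φ k).toFun s i j) 2
      (volume.restrict (Icc 0 T))) atTop (𝓝 0)) ∧
    ∀ t ∈ Icc 0 T, Tendsto (fun k => eLpNorm (fun ω => M t ω - (φ k).integral W t ω) 2 P)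
      atTop (𝓝 0)

/-- `σ(x₀, W_s, s ≤ t)`, the information of one player at time `t`. -/
@[reducible]
def info {d : ℕ} {Ω : Type*} (x₀ : Ω → Vec d) (W : ℝ≥0 → Ω → Vec d) (t : ℝ) :
    MeasurableSpace Ω :=
  MeasurableSpace.comap x₀ inferInstance ⊔
    ⨆ s : ℝ≥0, ⨆ _ : s ≤ t.toNNReal, MeasurableSpace.comap (W s) inferInstance

/-- `σ((x₀¹,…,x₀ᴺ), (W¹_s,…,Wᴺ_s), s ≤ t)`, the joint information of all players. -/
@[reducible]
def jointInfo {d N : ℕ} {Ω : Type*} (x₀ : Fin N → Ω → Vec d) (W : Fin N → ℝ≥0 → Ω → Vec d)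
    (t : ℝ) : MeasurableSpace Ω :=
  ⨆ i, info (x₀ i) (W i) t

/-- Admissible controls, the space `L²_F(0,T;ℝᵐ)`: jointly measurable, square integrable on
`[0,T] × Ω`, and adapted (up to null sets). -/
structure IsAdmissible {m : ℕ} {Ω : Type*} [MeasurableSpace Ω] (P : Measure Ω) (T : ℝ)
    (F : ℝ → MeasurableSpace Ω) (v : ℝ → Ω → Vec m) : Prop where
  memLp : MemLp (fun p : ℝ × Ω => v p.1 p.2) 2 ((volume.restrict (Icc 0 T)).prod P)
  adapted : ∀ t ∈ Icc 0 T, AEStronglyMeasurable[F t] (v t) P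

/-- `x` is a continuous, adapted (up to null sets) solution on `[0,T]` of
`dx_t = (A_t x_t + B_t v_t + Ā_t q_t) dt + σ_t dW_t`, `x(0) = x₀`,
with control `v` and mean field term `q`. -/
structure IsState {n m : ℕ} {Ω : Type*} [MeasurableSpace Ω] (D : Data n m) (P : Measure Ω)
    (F : ℝ → MeasurableSpace Ω) (x₀ : Ω → Vec n) (W : ℝ≥0 → Ω → Vec n)
    (v : ℝ → Ω → Vec m) (q : ℝ → Ω → Vec n) (x : ℝ → Ω → Vec n) : Prop where
  adapted : ∀ t ∈ Icc 0 D.T, AEStronglyMeasurable[F t] (x t) P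
  continuous : ∀ᵐ ω ∂P, ContinuousOn (fun t => x t ω) (Icc 0 D.T)
  equation : ∃ M : ℝ → Ω → Vec n, IsWienerIntegral P D.T D.σ W M ∧
    ∀ᵐ ω ∂P, ∀ t ∈ Icc 0 D.T,
      x t ω = x₀ ω
        + (∫ s in (0 : ℝ)..t, (mv (D.A s) (x s ω) + mv (D.B s) (v s ω) + mv (D.Abar s) (q s ω)))
        + M t ω

/-- The cost `J` of a control `v` with trajectory `x`, when the mean field term is `z`. All
integrands are non-negative, so it is a well-defined element of `[0,∞]`. -/
noncomputable def cost {n m : ℕ} {Ω : Type*} [MeasurableSpace Ω] (D : Data n m) (P : Measure Ω)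
    (z : ℝ → Vec n) (v : ℝ → Ω → Vec m) (x : ℝ → Ω → Vec n) : ℝ≥0∞ :=
  (∫⁻ ω, (∫⁻ t in Icc 0 D.T, ENNReal.ofReal ((1 / 2 : ℝ) *
      (quad (D.Q t) (x t ω) + quad (D.R t) (v t ω)
        + quad (D.Qbar t) (x t ω - mv (D.S t) (z t))))) ∂P)
  + ∫⁻ ω, ENNReal.ofReal ((1 / 2 : ℝ) *
      (quad (D.Q D.T) (x D.T ω)
        + quad (D.Qbar D.T) (x D.T ω - mv (D.S D.T) (z D.T)))) ∂P

/-- `u` is an equilibrium strategy of the mean field game driven by `(x₀, W)`, with trajectory `y`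
and mean field `z`: the mean of `y` is `z`, and `u` minimizes the cost with mean field term `z`
over all controls adapted to the information generated by `(x₀, W)`. -/
structure IsMFGEquilibrium {n m : ℕ} {Ω : Type*} [MeasurableSpace Ω] (D : Data n m)
    (P : Measure Ω) (x₀ : Ω → Vec n) (W : ℝ≥0 → Ω → Vec n) (z : ℝ → Vec n)
    (u : ℝ → Ω → Vec m) (y : ℝ → Ω → Vec n) : Prop where
  z_continuous : ContinuousOn z (Icc 0 D.T)
  admissible : IsAdmissible P D.T (info x₀ W) u
  state : IsState D P (info x₀ W) x₀ W u (fun t _ => z t) y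
  integrable : ∀ t ∈ Icc 0 D.T, Integrable (y t) P
  mean : ∀ t ∈ Icc 0 D.T, z t = ∫ ω, y t ω ∂P
  optimal : ∀ (v : ℝ → Ω → Vec m) (x : ℝ → Ω → Vec n), IsAdmissible P D.T (info x₀ W) v →
    IsState D P (info x₀ W) x₀ W v (fun t _ => z t) x → cost D P z u y ≤ cost D P z v x

/-- The initial states and noises of `N` players: `x₀ⁱ` has law `μ₀`, `Wⁱ` is a standard Wiener
process independent of `x₀ⁱ`, and the pairs `(x₀ⁱ, Wⁱ)` are independent for different players.
Hence `x₀¹,…,x₀ᴺ,W¹,…,Wᴺ` are mutually independent. -/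
structure IsPlayers {n N : ℕ} {Ω : Type*} [MeasurableSpace Ω] (P : Measure Ω)
    (μ₀ : Measure (Vec n)) (x₀ : Fin N → Ω → Vec n) (W : Fin N → ℝ≥0 → Ω → Vec n) : Prop where
  measurable : ∀ i, Measurable (x₀ i)
  law : ∀ i, P.map (x₀ i) = μ₀
  wiener : ∀ i, IsWiener P (W i)
  indep_init : ∀ i, IndepFun (x₀ i) (fun ω t => W i t ω) P
  indep : iIndepFun (fun (i : Fin N) (ω : Ω) => (x₀ i ω, fun t => W i t ω)) P

/-- The empirical mean of the other players, `(N-1)⁻¹ ∑_{j ≠ i} yʲ_t`. -/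
noncomputable def othersMean {n N : ℕ} {Ω : Type*} (y : Fin N → ℝ → Ω → Vec n) (i : Fin N)
    (t : ℝ) (ω : Ω) : Vec n :=
  ((N : ℝ) - 1)⁻¹ • ∑ j ∈ Finset.univ.erase i, y j t ω

end LQMFG

namespace LQMFG

/-! Both systems carry the same controls and the same noises, so these cancel in the errors `eⁱ = yⁱ
- ŷⁱ`. What remains is linear, with zero initial value: `eⁱ_t = ∫₀ᵗ (A eⁱ + Ā ((N-1)⁻¹ ∑_{j≠i} eʲ +
hⁱ)) ds`, where `hⁱ = (N-1)⁻¹ ∑_{j≠i} (ŷʲ - z)` is the fluctuation of the other equilibrium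
trajectories around their common mean. Grönwall's inequality for `∑ ‖eʲ‖`, at a rate that does not
depend on `N`, and then for each `‖eⁱ‖`, bounds the errors pathwise and uniformly in time by `∫
‖hⁱ‖` and the average of the `∫ ‖hʲ‖` (`norm_coupled_le`, `ae_enorm_sub_le`).

The trajectories of different players are independent, because each is adapted to its own player's
information. Hence the second moment of `hⁱ_t` is at most `V / (N-1)`, where `V` bounds the second
moments of the `ŷʲ_t` (`lintegral_sq_fluctuation_le`). Cauchy–Schwarz, in time and over the players,
turns this into the rate `1/N`.

The constant `V` must not depend on the probability space or on the chosen equilibrium. It comes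
from optimality: the cost dominates `δ/2` times the energy of the control, and is at most the cost
of the zero control, which the data bound; a bounded energy then bounds the moments of the state
(`exists_equilibrium_moment_bound`). This needs an adapted trajectory for the zero control, built by
Picard iteration. Since a stochastic integral is given only as an `L²` limit of elementary
integrals, the Itô isometry for step functions supplies its uniqueness and its moment bound. -/

/-! ### Grönwall's inequality and linear Volterra equations -/

theorem intervalIntegral_congr_Icc {E : Type*} [NormedAddCommGroup E] [NormedSpace ℝ E]
    {f g : ℝ → E} {T t : ℝ} (ht : t ∈ Icc 0 T) (h : ∀ s ∈ Icc 0 T, f s = g s) :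
    ∫ s in (0 : ℝ)..t, f s = ∫ s in (0 : ℝ)..t, g s := by
  apply intervalIntegral.integral_congr
  intro s hs
  rw [uIcc_of_le ht.1] at hs
  exact h s ⟨hs.1, hs.2.trans ht.2⟩

/-- Grönwall's inequality in integral form. -/
theorem le_mul_exp_of_le_add_integral {f : ℝ → ℝ} {c K T : ℝ} (hK : 0 ≤ K) (hT : 0 ≤ T)
    (hf : ContinuousOn f (Icc 0 T))
    (h : ∀ t ∈ Icc 0 T, f t ≤ c + K * ∫ s in (0 : ℝ)..t, f s) :
    ∀ t ∈ Icc 0 T, f t ≤ c * Real.exp (K * t) := by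
  -- Extending `f` continuously to the whole line makes its primitive differentiable everywhere; the
  -- differential Grönwall inequality is then applied to the primitive, which starts at `0`.
  obtain ⟨g, hg, hfg⟩ : ∃ g : ℝ → ℝ, Continuous g ∧ ∀ t ∈ Icc 0 T, f t = g t :=
    ⟨IccExtend hT ((Icc 0 T).domRestrict f), (continuousOn_iff_continuous_domRestrict.1 hf).Icc_extend',
      fun t ht => by rw [IccExtend_of_mem _ _ ht]; rfl⟩
  have hder : ∀ x : ℝ, HasDerivAt (fun t => ∫ s in (0 : ℝ)..t, g s) (g x) x := fun x =>
    intervalIntegral.integral_hasDerivAt_right (hg.intervalIntegrable _ _)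
      (hg.stronglyMeasurableAtFilter _ _) hg.continuousAt
  have hb : ∀ t ∈ Icc 0 T, g t ≤ c + K * ∫ s in (0 : ℝ)..t, g s := fun t ht => by
    rw [← hfg t ht, ← intervalIntegral_congr_Icc ht hfg]
    exact h t ht
  have key := le_gronwallBound_of_liminf_deriv_right_le (f := fun t => ∫ s in (0 : ℝ)..t, g s)
    (f' := g) (δ := 0) (K := K) (ε := c) (a := 0) (b := T)
    (fun x _ => (hder x).continuousAt.continuousWithinAt)
    (fun x _ r hr => ((hder x).hasDerivWithinAt).liminf_right_slope_le hr)
    (by simp) (fun x hx => by linarith [hb x ⟨hx.1, hx.2.le⟩])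
  intro t ht
  rw [hfg t ht]
  refine (hb t ht).trans ?_
  have := mul_le_mul_of_nonneg_left (key t ht) hK
  refine (add_le_add_right this c).trans (le_of_eq ?_)
  -- The primitive is at most `(c / K) * (exp (K * t) - 1)`, and `c + K * _` collapses this to `c *
  -- exp (K * t)`. At `K = 0`, `gronwallBound` is given by a different formula.
  by_cases hK0 : K = 0
  · simp [hK0]
  · rw [gronwallBound_of_K_ne_0 hK0]
    field_simp
    ring_nf

section
variable {E : Type*} [NormedAddCommGroup E] [NormedSpace ℝ E]

theorem intervalIntegrable_of_Icc {F : Type*} [NormedAddCommGroup F] {f : ℝ → F} {T t : ℝ}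
    (ht : t ∈ Icc 0 T) (hf : IntegrableOn f (Icc 0 T)) : IntervalIntegrable f volume 0 t := by
  rw [intervalIntegrable_iff_integrableOn_Icc_of_le ht.1]
  exact hf.mono_set (Icc_subset_Icc_right ht.2)

theorem integrableOn_clm_apply {F : Type*} [NormedAddCommGroup F] [NormedSpace ℝ F]
    {L : ℝ → E →L[ℝ] F} {f : ℝ → E} {T K : ℝ}
    (hL : AEStronglyMeasurable L (volume.restrict (Icc 0 T))) (hK : ∀ t ∈ Icc 0 T, ‖L t‖ ≤ K)
    (hf : IntegrableOn f (Icc 0 T)) : IntegrableOn (fun s => L s (f s)) (Icc 0 T) := by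
  refine Integrable.mono' (hf.norm.const_mul K) 
    ((isBoundedBilinearMap_apply (𝕜 := ℝ)).continuous.comp_aestronglyMeasurable (hL.prodMk hf.1)) ?_
  filter_upwards [ae_restrict_mem measurableSet_Icc] with t ht
  exact ((L t).le_opNorm _).trans (mul_le_mul_of_nonneg_right (hK t ht) (norm_nonneg _))

/-- A bound for `∫₀ᵗ L f` when `‖L‖ ≤ K`. -/
theorem norm_integral_clm_apply_le {F : Type*} [NormedAddCommGroup F] [NormedSpace ℝ F]
    {L : ℝ → E →L[ℝ] F} {f : ℝ → E} {T K t : ℝ} (hK : ∀ t ∈ Icc 0 T, ‖L t‖ ≤ K)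
    (hf : IntegrableOn f (Icc 0 T)) (ht : t ∈ Icc 0 T) :
    ‖∫ s in (0 : ℝ)..t, L s (f s)‖ ≤ K * ∫ s in (0 : ℝ)..t, ‖f s‖ := by
  rw [← intervalIntegral.integral_const_mul]
  refine intervalIntegral.norm_integral_le_of_norm_le ht.1 (Eventually.of_forall fun s hs => ?_)
    ((intervalIntegrable_of_Icc ht hf).norm.const_mul K)
  exact ((L s).le_opNorm _).trans
    (mul_le_mul_of_nonneg_right (hK s ⟨hs.1.le, hs.2.trans ht.2⟩) (norm_nonneg _))

theorem continuousOn_primitive_Icc {f : ℝ → E} {T : ℝ} (hT : 0 ≤ T)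
    (hf : IntegrableOn f (Icc 0 T)) : ContinuousOn (fun t => ∫ s in (0 : ℝ)..t, f s) (Icc 0 T) := by
  have := intervalIntegral.continuousOn_primitive_interval (μ := volume) (f := f) (a := 0) (b := T)
    (by rwa [uIcc_of_le hT])
  rwa [uIcc_of_le hT] at this

/-- Picard iterates for the linear Volterra equation `x_t = g_t + ∫₀ᵗ L_s x_s ds`. -/
noncomputable def picard (L : ℝ → E →L[ℝ] E) (g : ℝ → E) : ℕ → ℝ → E
  | 0 => g
  | k + 1 => fun t => g t + ∫ s in (0 : ℝ)..t, L s (picard L g k s)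

section
variable {L : ℝ → E →L[ℝ] E} {g : ℝ → E} {T K : ℝ}

theorem picard_continuousOn (hT : 0 ≤ T)
    (hL : AEStronglyMeasurable L (volume.restrict (Icc 0 T))) (hK : ∀ t ∈ Icc 0 T, ‖L t‖ ≤ K)
    (hg : ContinuousOn g (Icc 0 T)) (k : ℕ) : ContinuousOn (picard L g k) (Icc 0 T) := by
  induction k with
  | zero => exact hg
  | succ k ih =>
    exact hg.add (continuousOn_primitive_Icc hT
      (integrableOn_clm_apply hL hK (ih.integrableOn_compact isCompact_Icc)))

/-- Each integration in time of `(K * s) ^ (k + 1) / (k + 1)!`, multiplied by `K`, gives the next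
term of the exponential series; this makes the increments summable uniformly in time. -/
theorem norm_picard_succ_sub_le (hT : 0 ≤ T) (hK0 : 0 ≤ K)
    (hL : AEStronglyMeasurable L (volume.restrict (Icc 0 T))) (hK : ∀ t ∈ Icc 0 T, ‖L t‖ ≤ K)
    (hg : ContinuousOn g (Icc 0 T)) {G : ℝ} (hG : ∀ t ∈ Icc 0 T, ‖g t‖ ≤ G) (k : ℕ) :
    ∀ t ∈ Icc 0 T, ‖picard L g (k + 1) t - picard L g k t‖
      ≤ G * ((K * t) ^ (k + 1) / (k + 1).factorial) := by
  have hi : ∀ k, IntegrableOn (picard L g k) (Icc 0 T) := fun k =>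
    (picard_continuousOn hT hL hK hg k).integrableOn_compact isCompact_Icc
  have hi' : ∀ k, ∀ t ∈ Icc 0 T,
      IntervalIntegrable (fun s => L s (picard L g k s)) volume 0 t := fun k t ht =>
    intervalIntegrable_of_Icc ht (integrableOn_clm_apply hL hK (hi k))
  induction k with
  | zero =>
    intro t ht
    simp only [picard, add_sub_cancel_left]
    refine (norm_integral_clm_apply_le hK (hi 0) ht).trans ?_
    have h1 : ∫ s in (0 : ℝ)..t, ‖g s‖ ≤ ∫ s in (0 : ℝ)..t, G :=
      intervalIntegral.integral_mono_on ht.1 (intervalIntegrable_of_Icc ht (hi 0)).norm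
        (by simp) (fun s hs => hG s ⟨hs.1, hs.2.trans ht.2⟩)
    have h2 := mul_le_mul_of_nonneg_left h1 hK0
    simp only [intervalIntegral.integral_const, smul_eq_mul, sub_zero] at h2
    simpa [picard, mul_comm, mul_left_comm] using h2
  | succ k ih =>
    intro t ht
    have h0 : picard L g (k + 1 + 1) t - picard L g (k + 1) t
        = ∫ s in (0 : ℝ)..t, L s (picard L g (k + 1) s - picard L g k s) := by
      conv_lhs => rw [picard, picard]
      simp only [map_sub]
      rw [intervalIntegral.integral_sub (hi' (k + 1) t ht) (hi' k t ht), add_sub_add_left_eq_sub]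
      rfl
    rw [h0]
    refine (norm_integral_clm_apply_le hK ((hi (k + 1)).sub (hi k)) ht).trans ?_
    have h1 : ∫ s in (0 : ℝ)..t, ‖picard L g (k + 1) s - picard L g k s‖
        ≤ ∫ s in (0 : ℝ)..t, G * ((K * s) ^ (k + 1) / (k + 1).factorial) :=
      intervalIntegral.integral_mono_on ht.1
        (intervalIntegrable_of_Icc ht ((hi (k + 1)).sub (hi k))).norm
        (by apply Continuous.intervalIntegrable; fun_prop)
        (fun s hs => ih s ⟨hs.1, hs.2.trans ht.2⟩)
    refine (mul_le_mul_of_nonneg_left h1 hK0).trans (le_of_eq ?_)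
    have h2 : (fun s : ℝ => G * ((K * s) ^ (k + 1) / (k + 1).factorial))
        = fun s => (G * K ^ (k + 1) / (k + 1).factorial) * s ^ (k + 1) := by
      ext s; rw [mul_pow]; ring
    rw [h2, intervalIntegral.integral_const_mul, integral_pow, Nat.factorial_succ (k + 1)]
    push_cast
    field_simp
    ring

/-- The linear Volterra equation is solved by the limit of the Picard iterates. -/
theorem exists_tendsto_picard [CompleteSpace E] (hT : 0 ≤ T)
    (hL : AEStronglyMeasurable L (volume.restrict (Icc 0 T))) (hK : ∀ t ∈ Icc 0 T, ‖L t‖ ≤ K)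
    (hg : ContinuousOn g (Icc 0 T)) :
    ∃ x : ℝ → E, ContinuousOn x (Icc 0 T) ∧
      (∀ t ∈ Icc 0 T, Tendsto (fun k => picard L g k t) atTop (𝓝 (x t))) ∧
      ∀ t ∈ Icc 0 T, x t = g t + ∫ s in (0 : ℝ)..t, L s (x s) := by
  have hK0 : 0 ≤ K := (norm_nonneg _).trans (hK 0 ⟨le_rfl, hT⟩)
  obtain ⟨G, hG⟩ := isCompact_Icc.exists_bound_of_continuousOn hg
  have hG0 : 0 ≤ G := (norm_nonneg _).trans (hG 0 ⟨le_rfl, hT⟩)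
  have hsum : Summable fun k : ℕ => G * ((K * T) ^ (k + 1) / (k + 1).factorial) :=
    ((summable_nat_add_iff 1).2 (Real.summable_pow_div_factorial (K * T))).mul_left G
  have hbd : ∀ (k : ℕ), ∀ t ∈ Icc 0 T, ‖picard L g (k + 1) t - picard L g k t‖
      ≤ G * ((K * T) ^ (k + 1) / (k + 1).factorial) := fun k t ht => by
    refine (norm_picard_succ_sub_le hT hK0 hL hK hg hG k t ht).trans ?_
    have := ht.1
    have := ht.2
    gcongr
  have hunif := tendstoUniformlyOn_tsum_nat hsum hbd
  have htel : ∀ (k : ℕ) (t : ℝ),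
      ∑ j ∈ Finset.range k, (picard L g (j + 1) t - picard L g j t) = picard L g k t - g t :=
    fun k t => by rw [Finset.sum_range_sub (fun j => picard L g j t)]; rfl
  simp only [htel] at hunif
  -- The telescoping series of increments converges uniformly, so `g + r` is a continuous limit of
  -- the iterates.
  set r : ℝ → E := fun t => ∑' k : ℕ, (picard L g (k + 1) t - picard L g k t) with hr
  have hcont := picard_continuousOn hT hL hK hg
  have hrc : ContinuousOn r (Icc 0 T) :=
    hunif.continuousOn (Frequently.of_forall fun k => (hcont k).sub hg)
  have hlim : ∀ t ∈ Icc 0 T, Tendsto (fun k => picard L g k t) atTop (𝓝 (g t + r t)) := by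
    intro t ht
    simpa using (hunif.tendsto_at ht).const_add (g t)
  have hxc : ContinuousOn (fun t => g t + r t) (Icc 0 T) := hg.add hrc
  refine ⟨fun t => g t + r t, hxc, hlim, fun t ht => ?_⟩
  refine tendsto_nhds_unique ((tendsto_add_atTop_iff_nat 1).2 (hlim t ht)) ?_
  simp only [picard]
  refine Tendsto.const_add _ ?_
  -- The iterates are bounded by `G` plus the sum of all increment bounds, which allows passing to
  -- the limit in the recursion.
  refine intervalIntegral.tendsto_integral_filter_of_dominated_convergence
    (fun _ => K * (G + ∑' k : ℕ, G * ((K * T) ^ (k + 1) / (k + 1).factorial))) ?_ ?_ (by simp) ?_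
  · refine Eventually.of_forall fun k => ?_
    rw [uIoc_of_le ht.1]
    exact ((integrableOn_clm_apply hL hK ((hcont k).integrableOn_compact isCompact_Icc)).mono_set
      ((Ioc_subset_Icc_self).trans (Icc_subset_Icc_right ht.2))).1
  · refine Eventually.of_forall fun k => Eventually.of_forall fun s hs => ?_
    rw [uIoc_of_le ht.1] at hs
    have hs' : s ∈ Icc 0 T := ⟨hs.1.le, hs.2.trans ht.2⟩
    refine ((L s).le_opNorm _).trans (mul_le_mul (hK s hs') ?_ (norm_nonneg _) hK0)
    have h1 : ‖picard L g k s - g s‖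
        ≤ ∑' k : ℕ, G * ((K * T) ^ (k + 1) / (k + 1).factorial) := by
      rw [← htel]
      refine (norm_sum_le _ _).trans ((Finset.sum_le_sum fun j _ => hbd j s hs').trans ?_)
      exact hsum.sum_le_tsum _ fun j _ => by positivity
    calc ‖picard L g k s‖ = ‖g s + (picard L g k s - g s)‖ := by rw [add_sub_cancel]
      _ ≤ _ := (norm_add_le _ _).trans (add_le_add (hG s hs') h1)
  · refine Eventually.of_forall fun s hs => ?_
    rw [uIoc_of_le ht.1] at hs
    exact ((L s).continuous.tendsto _).comp (hlim s ⟨hs.1.le, hs.2.trans ht.2⟩)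

end

end

/-! ### Cauchy–Schwarz and the Itô isometry for step integrands -/

/-- Cauchy–Schwarz for the integral of one nonnegative function. -/
theorem sq_lintegral_le {α : Type*} [MeasurableSpace α] {μ : Measure α} {f : α → ℝ≥0∞}
    (hf : AEMeasurable f μ) : (∫⁻ a, f a ∂μ) ^ 2 ≤ μ univ * ∫⁻ a, f a ^ 2 ∂μ := by
  have h := ENNReal.lintegral_mul_le_Lp_mul_Lq μ (p := 2) (q := 2)
    ⟨by norm_num, by norm_num, by norm_num⟩ hf (aemeasurable_const (b := (1 : ℝ≥0∞)))
  simp only [Pi.mul_apply, mul_one, ENNReal.one_rpow, lintegral_const, one_mul] at h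
  calc (∫⁻ a, f a ∂μ) ^ 2
      ≤ ((∫⁻ a, f a ^ (2 : ℝ) ∂μ) ^ (1 / 2 : ℝ) * μ univ ^ (1 / 2 : ℝ)) ^ 2 := by gcongr
    _ = _ := by
      rw [mul_pow, ← ENNReal.rpow_natCast, ← ENNReal.rpow_natCast, ← ENNReal.rpow_mul,
        ← ENNReal.rpow_mul]
      norm_num
      rw [mul_comm]

section
variable {Ω : Type*} [MeasurableSpace Ω] {P : Measure Ω}

theorem isBrownianReal_memLp {B : ℝ≥0 → Ω → ℝ} (hB : IsBrownianReal B P) (t : ℝ≥0) :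
    MemLp (B t) 2 P :=
  (hB.isGaussianProcess.hasGaussianLaw_eval t).memLp_two

/-- Itô isometry for elementary integrals, written as combinations of values of the process. -/
theorem brownian_isometry [IsProbabilityMeasure P] {B : ℝ≥0 → Ω → ℝ} (hB : IsBrownianReal B P)
    {ι : Type*} [Fintype ι] (d : ι → ℝ) (p : ι → ℝ≥0) (t : ℝ≥0) :
    eLpNorm (fun ω => ∑ i, d i * B (min (p i) t) ω) 2 P
      = eLpNorm (fun s : ℝ => ∑ i, d i * (Iic (p i : ℝ)).indicator (fun _ => (1 : ℝ)) s) 2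
          (volume.restrict (Ioc 0 (t : ℝ))) := by
  have hm : ∀ i, MemLp (fun ω => d i * B (min (p i) t) ω) 2 P := fun i =>
    (isBrownianReal_memLp hB _).const_mul _
  have hX : MemLp (fun ω => ∑ i, d i * B (min (p i) t) ω) 2 P := memLp_finsetSum _ fun i _ => hm i
  have hf1 : ∀ i, MemLp (fun s : ℝ => d i * (Iic (p i : ℝ)).indicator (fun _ => (1 : ℝ)) s) 2
      (volume.restrict (Ioc 0 (t : ℝ))) := fun i =>
    ((memLp_const (1 : ℝ)).indicator measurableSet_Iic).const_mul _
  have hf : MemLp (fun s : ℝ => ∑ i, d i * (Iic (p i : ℝ)).indicator (fun _ => (1 : ℝ)) s) 2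
      (volume.restrict (Ioc 0 (t : ℝ))) := memLp_finsetSum _ fun i _ => hf1 i
  rw [hX.eLpNorm_eq_integral_rpow_norm (by norm_num) (by norm_num),
    hf.eLpNorm_eq_integral_rpow_norm (by norm_num) (by norm_num)]
  congr 2
  simp only [ENNReal.toReal_ofNat, Real.rpow_ofNat, Real.norm_eq_abs, sq_abs]
  have hmean : P[fun ω => ∑ i, d i * B (min (p i) t) ω] = 0 := by
    rw [integral_finsetSum _ fun i _ => (hm i).integrable (by norm_num)]
    refine Finset.sum_eq_zero fun i _ => ?_
    rw [integral_const_mul, hB.integral_eval, mul_zero]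
  -- Both quadratic forms have the same Gram matrix: the covariance of the Brownian motion at times
  -- `p ∧ t` and `q ∧ t` is `p ∧ q ∧ t`, which is also the length of `(0, t] ∩ (-∞, p] ∩ (-∞, q]`.
  -- No ordering of the times is needed.
  have h1 : ∫ ω, (∑ i, d i * B (min (p i) t) ω) ^ 2 ∂P
      = ∑ i, ∑ j, d i * d j * (min (min (p i) t) (min (p j) t) : ℝ≥0) := by
    have := covariance_fun_sum_fun_sum (μ := P) hm hm
    rw [covariance_eq_sub hX hX, hmean, mul_zero, sub_zero] at this
    simp only [Pi.mul_apply, ← sq] at this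
    rw [this]
    refine Finset.sum_congr rfl fun i _ => Finset.sum_congr rfl fun j _ => ?_
    rw [covariance_const_mul_left, covariance_const_mul_right, hB.covariance_fun_eval]
    ring
  have h2 : ∫ s in Ioc 0 (t : ℝ),
        (∑ i, d i * (Iic (p i : ℝ)).indicator (fun _ => (1 : ℝ)) s) ^ 2
      = ∑ i, ∑ j, d i * d j * (min (min (p i) t) (min (p j) t) : ℝ≥0) := by
    have hij : ∀ i j, Integrable (fun s : ℝ =>
        d i * (Iic (p i : ℝ)).indicator (fun _ => (1 : ℝ)) s
          * (d j * (Iic (p j : ℝ)).indicator (fun _ => (1 : ℝ)) s))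
        (volume.restrict (Ioc 0 (t : ℝ))) := fun i j => (hf1 i).integrable_mul (hf1 j)
    simp only [sq, Finset.sum_mul_sum]
    rw [integral_finsetSum _ fun i _ => integrable_finsetSum _ fun j _ => hij i j]
    refine Finset.sum_congr rfl fun i _ => ?_
    rw [integral_finsetSum _ fun j _ => hij i j]
    refine Finset.sum_congr rfl fun j _ => ?_
    have : ∀ s : ℝ, (d i * (Iic (p i : ℝ)).indicator (fun _ => (1 : ℝ)) s)
        * (d j * (Iic (p j : ℝ)).indicator (fun _ => (1 : ℝ)) s)
        = d i * d j * (Iic ((min (p i) (p j) : ℝ≥0) : ℝ)).indicator (fun _ => (1 : ℝ)) s := by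
      intro s
      simp only [indicator, mem_Iic, NNReal.coe_min, le_min_iff]
      split_ifs <;> simp_all
    simp only [this]
    rw [integral_const_mul, integral_indicator measurableSet_Iic,
      Measure.restrict_restrict measurableSet_Iic, inter_comm, Ioc_inter_Iic]
    congr 1
    simp only [integral_const, smul_eq_mul, mul_one, measureReal_restrict_apply_univ,
      Real.volume_real_Ioc, sub_zero]
    rw [max_eq_left (by positivity), ← NNReal.coe_min, ← min_min_min_comm]
    simp [min_comm]
  rw [h1, h2]

theorem norm_le_sum_abs {d : ℕ} (x : Vec d) : ‖x‖ ≤ ∑ a, |x a| := by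
  rw [EuclideanSpace.norm_eq]
  refine Real.sqrt_le_iff.2 ⟨Finset.sum_nonneg fun _ _ => abs_nonneg _, ?_⟩
  simpa using Finset.sum_sq_le_sq_sum_of_nonneg (s := Finset.univ) fun (i : Fin d) _ => abs_nonneg (x i)

/-- An interval `(a, b]` with `a ≤ b` has indicator `1_{≤ b} - 1_{≤ a}`. This is the form required
by `brownian_isometry`, with the same coefficients as in `coordIntegral`. -/
theorem StepFn.toFun_apply {d : ℕ} (φ : StepFn d) (a b : Fin d) (s : ℝ) :
    φ.toFun s a b = ∑ i : Fin φ.k,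
      (φ.val i a b * (Iic (φ.τ i.succ : ℝ)).indicator (fun _ => (1 : ℝ)) s
        + -φ.val i a b * (Iic (φ.τ i.castSucc : ℝ)).indicator (fun _ => (1 : ℝ)) s) := by
  simp only [StepFn.toFun, Matrix.sum_apply]
  refine Finset.sum_congr rfl fun i _ => ?_
  have hle : (φ.τ i.castSucc : ℝ) ≤ φ.τ i.succ :=
    NNReal.coe_le_coe.2 (φ.mono (Fin.castSucc_lt_succ).le)
  simp only [indicator, mem_Ioc, mem_Iic]
  by_cases h1 : s ≤ φ.τ i.succ <;> by_cases h2 : s ≤ φ.τ i.castSucc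
  · simp [h1, h2, not_lt.2 h2]
  · simp [h1, h2, not_le.1 h2]
  · exact absurd (h2.trans hle) h1
  · simp [h1, h2]

/-- The contribution of the `b`-th noise to the `a`-th coordinate of the elementary integral. -/
noncomputable def StepFn.coordIntegral {Ω' : Type*} {d : ℕ} (φ : StepFn d)
    (W : ℝ≥0 → Ω' → Vec d) (t : ℝ) (a b : Fin d) (ω : Ω') : ℝ :=
  ∑ i : Fin φ.k,
      (φ.val i a b * W (min (φ.τ i.succ) t.toNNReal) ω b
        + -φ.val i a b * W (min (φ.τ i.castSucc) t.toNNReal) ω b)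

theorem StepFn.integral_apply {Ω' : Type*} {d : ℕ} (φ : StepFn d) (W : ℝ≥0 → Ω' → Vec d)
    (t : ℝ) (ω : Ω')
    (a : Fin d) : φ.integral W t ω a = ∑ b, φ.coordIntegral W t a b ω := by
  simp only [StepFn.integral, StepFn.coordIntegral, mv, WithLp.ofLp_sum, Finset.sum_apply,
    Matrix.mulVec, dotProduct]
  rw [Finset.sum_comm]
  refine Finset.sum_congr rfl fun b _ => Finset.sum_congr rfl fun i _ => ?_
  rw [PiLp.sub_apply]
  ring

theorem StepFn.coordIntegral_memLp {d : ℕ} {W : ℝ≥0 → Ω → Vec d} (hW : IsWiener P W)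
    (φ : StepFn d) (t : ℝ) (a b : Fin d) : MemLp (φ.coordIntegral W t a b) 2 P :=
  memLp_finsetSum _ fun _ _ => ((isBrownianReal_memLp (hW.brownian b) _).const_mul _).add
    ((isBrownianReal_memLp (hW.brownian b) _).const_mul _)

/-- Since `brownian_isometry` accepts arbitrary finite families of times, the endpoints of `φ` and
`ψ` are simply concatenated; no common refinement of the two partitions is needed. -/
theorem StepFn.eLpNorm_coordIntegral_sub [IsProbabilityMeasure P] {d : ℕ} {W : ℝ≥0 → Ω → Vec d}
    (hW : IsWiener P W) (φ ψ : StepFn d) {t : ℝ} (ht : 0 ≤ t) (a b : Fin d) :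
    eLpNorm (fun ω => φ.coordIntegral W t a b ω - ψ.coordIntegral W t a b ω) 2 P
      = eLpNorm (fun s => φ.toFun s a b - ψ.toFun s a b) 2 (volume.restrict (Ioc 0 t)) := by
  have h := brownian_isometry (hW.brownian b)
    (Sum.elim (Sum.elim (fun i => φ.val i a b) (fun i => -φ.val i a b))
        (Sum.elim (fun i => -ψ.val i a b) (fun i => ψ.val i a b)))
    (Sum.elim (Sum.elim (fun i => φ.τ i.succ) (fun i => φ.τ i.castSucc))
        (Sum.elim (fun i => ψ.τ i.succ) (fun i => ψ.τ i.castSucc))) t.toNNReal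
  rw [Real.coe_toNNReal _ ht] at h
  simp only [Fintype.sum_sum_type, Sum.elim_inl, Sum.elim_inr] at h
  convert h using 2
  · ext ω
    simp only [StepFn.coordIntegral, Finset.sum_add_distrib, neg_mul, Finset.sum_neg_distrib]
    ring
  · ext s
    simp only [StepFn.toFun_apply, Finset.sum_add_distrib, neg_mul, Finset.sum_neg_distrib]
    ring

/-- The elementary integrals depend continuously on the integrand. -/
theorem StepFn.eLpNorm_integral_sub_le [IsProbabilityMeasure P] {d : ℕ} {W : ℝ≥0 → Ω → Vec d}
    (hW : IsWiener P W) (φ ψ : StepFn d) {t T : ℝ} (ht : t ∈ Icc 0 T) :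
    eLpNorm (fun ω => φ.integral W t ω - ψ.integral W t ω) 2 P
      ≤ ∑ a, ∑ b, eLpNorm (fun s => φ.toFun s a b - ψ.toFun s a b) 2
          (volume.restrict (Icc 0 T)) := by
  have hfm : ∀ a b, AEStronglyMeasurable
      (fun ω => |φ.coordIntegral W t a b ω - ψ.coordIntegral W t a b ω|) P := fun a b =>
    (((φ.coordIntegral_memLp hW t a b).sub (ψ.coordIntegral_memLp hW t a b)).1).norm
  calc eLpNorm (fun ω => φ.integral W t ω - ψ.integral W t ω) 2 P
      ≤ eLpNorm (fun ω => ∑ a, ∑ b, |φ.coordIntegral W t a b ω - ψ.coordIntegral W t a b ω|)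
          2 P := by
        refine eLpNorm_mono_real fun ω => ?_
        refine (norm_le_sum_abs _).trans (Finset.sum_le_sum fun a _ => ?_)
        rw [PiLp.sub_apply, StepFn.integral_apply, StepFn.integral_apply, ← Finset.sum_sub_distrib]
        exact Finset.abs_sum_le_sum_abs _ _
    _ ≤ ∑ a, ∑ b, eLpNorm
          (fun ω => |φ.coordIntegral W t a b ω - ψ.coordIntegral W t a b ω|) 2 P := by
        have h := eLpNorm_sum_le (μ := P) (p := 2) (s := Finset.univ)
          (f := fun a ω => ∑ b, |φ.coordIntegral W t a b ω - ψ.coordIntegral W t a b ω|)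
          (fun a _ => Finset.aestronglyMeasurable_fun_sum _ fun b _ => hfm a b) (by norm_num)
        rw [Finset.sum_fn] at h
        refine h.trans (Finset.sum_le_sum fun a _ => ?_)
        have h := eLpNorm_sum_le (μ := P) (p := 2) (s := Finset.univ)
          (f := fun b ω => |φ.coordIntegral W t a b ω - ψ.coordIntegral W t a b ω|)
          (fun b _ => hfm a b) (by norm_num)
        rwa [Finset.sum_fn] at h
    _ ≤ _ := by
        refine Finset.sum_le_sum fun a _ => Finset.sum_le_sum fun b _ => ?_
        have h1 := eLpNorm_norm (μ := P) (p := 2)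
          (fun ω => φ.coordIntegral W t a b ω - ψ.coordIntegral W t a b ω)
        simp only [Real.norm_eq_abs] at h1
        rw [h1, StepFn.eLpNorm_coordIntegral_sub hW φ ψ ht.1]
        exact eLpNorm_mono_measure _
          (Measure.restrict_mono (Ioc_subset_Icc_self.trans (Icc_subset_Icc_right ht.2)) le_rfl)

end

/-! ### Joint measurability and time integrals of continuous processes -/

section
variable {Ω : Type*} {d : ℕ}

/-- Here `Z n k` stands for a process at time `k / (n + 1)`. The floor takes countably many values,
so each approximation is jointly measurable, and hence so is the limit. -/
theorem stronglyMeasurable_limUnder_floor [MeasurableSpace Ω] {Z : ℕ → ℕ → Ω → Vec d}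
    (hZ : ∀ n k, StronglyMeasurable (Z n k)) :
    StronglyMeasurable (fun p : ℝ × Ω =>
      limUnder atTop (fun n : ℕ => Z n ⌊((n : ℝ) + 1) * p.1⌋₊ p.2)) := by
  refine StronglyMeasurable.limUnder fun n => Measurable.stronglyMeasurable ?_
  have h : Measurable (fun q : ℕ × Ω => Z n q.1 q.2) :=
    measurable_from_prod_countable_right fun k => (hZ n k).measurable
  exact h.comp ((Nat.measurable_floor.comp (measurable_fst.const_mul _)).prodMk measurable_snd)

theorem stronglyMeasurable_integral_clm [MeasurableSpace Ω] {F : Type*} [NormedAddCommGroup F]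
    [NormedSpace ℝ F] {L : ℝ → Vec d →L[ℝ] F} (hL : StronglyMeasurable L) {Y : ℝ × Ω → Vec d}
    (hY : StronglyMeasurable Y) (t : ℝ) :
    StronglyMeasurable (fun ω => ∫ s in Ioc 0 t, L s (Y (s, ω))) := by
  have h : StronglyMeasurable (fun p : ℝ × Ω => L p.1 (Y p)) :=
    (isBoundedBilinearMap_apply (𝕜 := ℝ)).continuous.comp_stronglyMeasurable
      ((hL.comp_measurable measurable_fst).prodMk hY)
  exact h.integral_prod_left'

variable {m m0 : MeasurableSpace Ω} {P : Measure[m0] Ω} {X : ℝ → Ω → Vec d} {T : ℝ}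

/-- An adapted and almost surely continuous process has a jointly measurable version. -/
theorem exists_jointly_stronglyMeasurable (hT : 0 ≤ T)
    (had : ∀ s ∈ Icc 0 T, AEStronglyMeasurable[m] (X s) P)
    (hc : ∀ᵐ ω ∂P, ContinuousOn (fun s => X s ω) (Icc 0 T)) :
    ∃ Y : ℝ × Ω → Vec d, @StronglyMeasurable (ℝ × Ω) (Vec d) _ (@Prod.instMeasurableSpace ℝ Ω _ m) Y ∧
      ∀ᵐ ω ∂P, ∀ s ∈ Icc 0 T, Y (s, ω) = X s ω := by
  -- Grid times are truncated at `T`, since nothing is known about the process beyond `T`.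
  have hq : ∀ n k : ℕ, min ((k : ℝ) / ((n : ℝ) + 1)) T ∈ Icc 0 T := fun n k =>
    ⟨le_min (by positivity) hT, min_le_right _ _⟩
  choose Z hZ hXZ using fun n k : ℕ => had _ (hq n k)
  refine ⟨_, @stronglyMeasurable_limUnder_floor Ω d m Z hZ, ?_⟩
  have hall : ∀ᵐ ω ∂P, ∀ n k : ℕ, X (min ((k : ℝ) / ((n : ℝ) + 1)) T) ω = Z n k ω :=
    ae_all_iff.2 fun n => ae_all_iff.2 fun k => hXZ n k
  filter_upwards [hc, hall] with ω hω hωZ s hs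
  refine Tendsto.limUnder_eq ?_
  simp only [← hωZ]
  refine (hω s hs).tendsto.comp (tendsto_nhdsWithin_iff.2 ⟨?_, Eventually.of_forall fun n => hq n _⟩)
  have h1 : Tendsto (fun n : ℕ => (⌊((n : ℝ) + 1) * s⌋₊ : ℝ) / ((n : ℝ) + 1)) atTop (𝓝 s) := by
    have := (tendsto_nat_floor_mul_div_atTop (R := ℝ) hs.1).comp
      (tendsto_atTop_add_const_right atTop (1 : ℝ) tendsto_natCast_atTop_atTop)
    refine this.congr fun n => ?_
    simp [mul_comm]
  simpa [min_eq_left hs.2] using h1.min (tendsto_const_nhds (x := T))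

/-- The jointly measurable version is `m`-measurable in its second variable, so integrating out time
leaves an `m`-measurable function. With `m` the information at the upper limit of integration, this
preserves adaptedness. -/
theorem aestronglyMeasurable_integral_clm {F : Type*} [NormedAddCommGroup F] [NormedSpace ℝ F]
    {L : ℝ → Vec d →L[ℝ] F} (hL : AEStronglyMeasurable L (volume.restrict (Icc 0 T))) (hT : 0 ≤ T)
    (had : ∀ s ∈ Icc 0 T, AEStronglyMeasurable[m] (X s) P)
    (hc : ∀ᵐ ω ∂P, ContinuousOn (fun s => X s ω) (Icc 0 T)) :
    AEStronglyMeasurable[m] (fun ω => ∫ s in (0 : ℝ)..T, L s (X s ω)) P := by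
  obtain ⟨Y, hY, hXY⟩ := exists_jointly_stronglyMeasurable hT had hc
  refine ⟨_, @stronglyMeasurable_integral_clm Ω d m F _ _ _ hL.stronglyMeasurable_mk Y hY T, ?_⟩
  filter_upwards [hXY] with ω hω
  rw [intervalIntegral.integral_of_le hT]
  refine integral_congr_ae ?_
  filter_upwards [ae_restrict_mem measurableSet_Ioc,
    ae_mono (Measure.restrict_mono Ioc_subset_Icc_self le_rfl) hL.ae_eq_mk] with s hs hLs
  rw [hω s ⟨hs.1.le, hs.2⟩, hLs]

end

section
variable {Ω : Type*} {d : ℕ}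
  [MeasurableSpace Ω] {P : Measure Ω} {X : ℝ → Ω → Vec d} {T : ℝ}

theorem aestronglyMeasurable_uncurry_swap [SFinite P] (hT : 0 ≤ T)
    (had : ∀ s ∈ Icc 0 T, AEStronglyMeasurable (X s) P)
    (hc : ∀ᵐ ω ∂P, ContinuousOn (fun s => X s ω) (Icc 0 T)) :
    AEStronglyMeasurable (fun p : Ω × ℝ => X p.2 p.1) (P.prod (volume.restrict (Icc 0 T))) := by
  obtain ⟨Y, hY, hXY⟩ := exists_jointly_stronglyMeasurable hT had hc
  refine ⟨fun p => Y p.swap, hY.comp_measurable measurable_swap, ?_⟩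
  have h1 : ∀ᵐ p ∂(P.prod (volume.restrict (Icc 0 T))), ∀ s ∈ Icc 0 T, Y (s, p.1) = X s p.1 :=
    Measure.quasiMeasurePreserving_fst.ae hXY
  have h2 : ∀ᵐ p ∂(P.prod (volume.restrict (Icc 0 T))), p.2 ∈ Icc 0 T :=
    Measure.quasiMeasurePreserving_snd.ae (ae_restrict_mem measurableSet_Icc)
  filter_upwards [h1, h2] with p hp hp2
  exact (hp _ hp2).symm

/-- The second moment of the time integral of an almost surely continuous process. -/
theorem lintegral_sq_lintegral_le [SFinite P] (hT : 0 ≤ T)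
    (had : ∀ s ∈ Icc 0 T, AEStronglyMeasurable (X s) P)
    (hc : ∀ᵐ ω ∂P, ContinuousOn (fun s => X s ω) (Icc 0 T)) {V : ℝ≥0∞}
    (hV : ∀ s ∈ Icc 0 T, ∫⁻ ω, ‖X s ω‖ₑ ^ 2 ∂P ≤ V) :
    ∫⁻ ω, (∫⁻ s in Icc 0 T, ‖X s ω‖ₑ) ^ 2 ∂P ≤ ENNReal.ofReal T ^ 2 * V := by
  have hm := aestronglyMeasurable_uncurry_swap hT had hc
  calc ∫⁻ ω, (∫⁻ s in Icc 0 T, ‖X s ω‖ₑ) ^ 2 ∂P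
      ≤ ∫⁻ ω, (ENNReal.ofReal T * ∫⁻ s in Icc 0 T, ‖X s ω‖ₑ ^ 2) ∂P := by
        refine lintegral_mono_ae ?_
        filter_upwards [hc] with ω hω
        refine (sq_lintegral_le (hω.aestronglyMeasurable measurableSet_Icc).enorm).trans ?_
        simp
    _ = ENNReal.ofReal T * ∫⁻ s in Icc 0 T, ∫⁻ ω, ‖X s ω‖ₑ ^ 2 ∂P := by
        rw [lintegral_const_mul' _ _ ENNReal.ofReal_ne_top,
          lintegral_lintegral_swap (f := fun ω s => ‖X s ω‖ₑ ^ 2)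
            (hm.enorm.pow_const 2)]
    _ ≤ ENNReal.ofReal T * ∫⁻ s in Icc 0 T, V := by
        gcongr 1
        exact setLIntegral_mono' measurableSet_Icc hV
    _ = _ := by
        simp [sq, mul_comm, mul_left_comm]

theorem aemeasurable_lintegral_enorm [SFinite P] (hT : 0 ≤ T)
    (had : ∀ s ∈ Icc 0 T, AEStronglyMeasurable (X s) P)
    (hc : ∀ᵐ ω ∂P, ContinuousOn (fun s => X s ω) (Icc 0 T)) :
    AEMeasurable (fun ω => ∫⁻ s in Icc 0 T, ‖X s ω‖ₑ) P :=
  (aestronglyMeasurable_uncurry_swap hT had hc).enorm.lintegral_prod_right'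

/-- Continuous processes which agree almost surely at each time are indistinguishable. -/
theorem indistinguishable_of_forall_ae_eq {X' : ℝ → Ω → Vec d}
    (hc : ∀ᵐ ω ∂P, ContinuousOn (fun s => X s ω) (Icc 0 T))
    (hc' : ∀ᵐ ω ∂P, ContinuousOn (fun s => X' s ω) (Icc 0 T))
    (h : ∀ t ∈ Icc 0 T, X t =ᵐ[P] X' t) : ∀ᵐ ω ∂P, ∀ t ∈ Icc 0 T, X t ω = X' t ω := by
  obtain ⟨D, hD, hDd⟩ := TopologicalSpace.exists_countable_dense (Icc (0 : ℝ) T)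
  have hall : ∀ᵐ ω ∂P, ∀ t ∈ D, X (t : Icc (0 : ℝ) T) ω = X' t ω :=
    (ae_ball_iff hD).2 fun t _ => h t t.2
  filter_upwards [hc, hc', hall] with ω h1 h2 h3 t ht
  have := Continuous.ext_on hDd (continuousOn_iff_continuous_domRestrict.1 h1)
    (continuousOn_iff_continuous_domRestrict.1 h2) (fun t ht => h3 t ht)
  exact congrFun this ⟨t, ht⟩

end

/-! ### Information of a player; uniqueness, size and adaptedness of Wiener integrals -/

/-- Matrix times vector as a continuous linear map. -/
noncomputable def mvL {a b : ℕ} (M : Matrix (Fin a) (Fin b) ℝ) : Vec b →L[ℝ] Vec a :=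
  LinearMap.toContinuousLinearMap (Matrix.toLpLin 2 2 M)

theorem mvL_apply {a b : ℕ} (M : Matrix (Fin a) (Fin b) ℝ) (x : Vec b) : mvL M x = mv M x := rfl

section
variable {Ω : Type*} {d : ℕ}

theorem info_le [MeasurableSpace Ω] {x₀ : Ω → Vec d} {W : ℝ≥0 → Ω → Vec d} (hx : Measurable x₀)
    (hW : ∀ t, Measurable (W t)) (t : ℝ) : info x₀ W t ≤ ‹MeasurableSpace Ω› :=
  sup_le hx.comap_le (iSup₂_le fun s _ => (hW s).comap_le)

theorem info_mono (x₀ : Ω → Vec d) (W : ℝ≥0 → Ω → Vec d) {s t : ℝ} (h : s ≤ t) :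
    info x₀ W s ≤ info x₀ W t :=
  sup_le_sup_left (iSup₂_le fun r hr => le_iSup₂_of_le (f := fun (r : ℝ≥0) (_ : r ≤ t.toNNReal) =>
    MeasurableSpace.comap (W r) inferInstance) r (hr.trans (Real.toNNReal_mono h)) le_rfl) _

theorem measurable_info_init (x₀ : Ω → Vec d) (W : ℝ≥0 → Ω → Vec d) (t : ℝ) :
    Measurable[info x₀ W t] x₀ :=
  (comap_measurable x₀).mono le_sup_left le_rfl

theorem measurable_info_noise (x₀ : Ω → Vec d) (W : ℝ≥0 → Ω → Vec d) (t : ℝ) {s : ℝ≥0}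
    (hs : s ≤ t.toNNReal) : Measurable[info x₀ W t] (W s) :=
  (comap_measurable (W s)).mono
    ((le_iSup₂ (f := fun (r : ℝ≥0) (_ : r ≤ t.toNNReal) =>
      MeasurableSpace.comap (W r) inferInstance) s hs).trans le_sup_right) le_rfl

theorem StepFn.stronglyMeasurable_integral (φ : StepFn d) (x₀ : Ω → Vec d)
    (W : ℝ≥0 → Ω → Vec d) (t : ℝ) : StronglyMeasurable[info x₀ W t] (φ.integral W t) := by
  let := info x₀ W t
  refine Finset.stronglyMeasurable_fun_sum _ fun i _ => ?_
  simp only [← mvL_apply]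
  refine (mvL (φ.val i)).continuous.comp_stronglyMeasurable ?_
  exact (measurable_info_noise x₀ W t (min_le_right _ _)).stronglyMeasurable.sub
    (measurable_info_noise x₀ W t (min_le_right _ _)).stronglyMeasurable

theorem StepFn.measurable_toFun (φ : StepFn d) (a b : Fin d) :
    Measurable (fun s => φ.toFun s a b) := by
  simp only [StepFn.toFun_apply]
  exact Finset.measurable_fun_sum _ fun i _ =>
    ((measurable_const.indicator measurableSet_Iic).const_mul _).add
      ((measurable_const.indicator measurableSet_Iic).const_mul _)

/-- The zero integrand. -/
def StepFn.zero (d : ℕ) : StepFn d where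
  k := 0
  τ := fun _ => 0
  mono := monotone_const
  val := fun i => i.elim0

theorem StepFn.zero_integral (W : ℝ≥0 → Ω → Vec d) (t : ℝ) (ω : Ω) :
    (StepFn.zero d).integral W t ω = 0 :=
  Fin.sum_univ_zero _

theorem StepFn.zero_toFun (s : ℝ) : (StepFn.zero d).toFun s = 0 :=
  Fin.sum_univ_zero _

/-- The σ-algebra `m` need not contain the null sets, so the limit is taken of `m`-measurable
versions of the `f k`. -/
theorem aestronglyMeasurable_of_forall_tendsto_ae {m m0 : MeasurableSpace Ω} {P : Measure[m0] Ω}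
    {f : ℕ → Ω → Vec d} {g : Ω → Vec d} (hf : ∀ k, AEStronglyMeasurable[m] (f k) P)
    (hlim : ∀ᵐ ω ∂P, Tendsto (fun k => f k ω) atTop (𝓝 (g ω))) :
    AEStronglyMeasurable[m] g P := by
  choose f' hf' hff' using hf
  refine ⟨fun ω => limUnder atTop (fun k => f' k ω),
    @StronglyMeasurable.limUnder _ _ _ m _ _ _ _ _ _ _ hf', ?_⟩
  filter_upwards [hlim, ae_all_iff.2 hff'] with ω h1 h2
  refine (Tendsto.limUnder_eq ?_).symm
  simpa only [← h2] using h1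

variable [MeasurableSpace Ω] {P : Measure Ω} {T : ℝ}
  {σ : ℝ → Matrix (Fin d) (Fin d) ℝ} {W : ℝ≥0 → Ω → Vec d} {M M' : ℝ → Ω → Vec d}

theorem StepFn.aestronglyMeasurable_integral (hW : ∀ t, Measurable (W t)) (φ : StepFn d) (t : ℝ) :
    AEStronglyMeasurable (φ.integral W t) P :=
  ((φ.stronglyMeasurable_integral 0 W t).mono (info_le measurable_const hW t)).aestronglyMeasurable

/-- The `N`-player state and the equilibrium state each come with their own version of the
stochastic integral; their noises cancel only because the versions agree. By the isometry,
elementary integrals of two approximating sequences differ by at most the distances of both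
sequences to `σ`. -/
theorem IsWienerIntegral.ae_eq [IsProbabilityMeasure P] (hW : IsWiener P W)
    (hσ : ∀ i j, AEStronglyMeasurable (fun t => σ t i j) (volume.restrict (Icc 0 T)))
    (hM : IsWienerIntegral P T σ W M) (hM' : IsWienerIntegral P T σ W M') {t : ℝ}
    (ht : t ∈ Icc 0 T) : M t =ᵐ[P] M' t := by
  obtain ⟨φ, hφ, hφM⟩ := hM.limit
  obtain ⟨ψ, hψ, hψM⟩ := hM'.limit
  have hI := fun χ : StepFn d => StepFn.aestronglyMeasurable_integral (P := P) hW.measurable χ t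
  have hle : ∀ k, eLpNorm (fun ω => M t ω - M' t ω) 2 P
      ≤ eLpNorm (fun ω => M t ω - (φ k).integral W t ω) 2 P
        + (∑ a, ∑ b, (eLpNorm (fun s => σ s a b - (φ k).toFun s a b) 2 (volume.restrict (Icc 0 T))
            + eLpNorm (fun s => σ s a b - (ψ k).toFun s a b) 2 (volume.restrict (Icc 0 T))))
        + eLpNorm (fun ω => M' t ω - (ψ k).integral W t ω) 2 P := by
    intro k
    have h1 : (fun ω => M t ω - M' t ω) = (fun ω => M t ω - (φ k).integral W t ω)
        + (fun ω => (φ k).integral W t ω - (ψ k).integral W t ω)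
        - (fun ω => M' t ω - (ψ k).integral W t ω) := by
      ext1 ω; simp only [Pi.add_apply, Pi.sub_apply]; abel
    rw [h1]
    refine (eLpNorm_sub_le (((hM.measurable t ht).sub (hI _)).add ((hI _).sub (hI _)))
      ((hM'.measurable t ht).sub (hI _)) (by norm_num)).trans ?_
    refine add_le_add_left ((eLpNorm_add_le ((hM.measurable t ht).sub (hI _)) ((hI _).sub (hI _))
      (by norm_num)).trans (add_le_add_right ?_ _)) _
    refine (StepFn.eLpNorm_integral_sub_le hW (φ k) (ψ k) ht).trans
      (Finset.sum_le_sum fun a _ => Finset.sum_le_sum fun b _ => ?_)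
    have h2 : (fun s => (φ k).toFun s a b - (ψ k).toFun s a b)
        = (fun s => σ s a b - (ψ k).toFun s a b) - (fun s => σ s a b - (φ k).toFun s a b) := by
      ext s; simp only [Pi.sub_apply]; ring
    rw [h2, add_comm]
    exact eLpNorm_sub_le
      ((hσ a b).sub ((ψ k).measurable_toFun a b).aestronglyMeasurable)
      ((hσ a b).sub ((φ k).measurable_toFun a b).aestronglyMeasurable) (by norm_num)
  have hlim := ((hφM t ht).add (tendsto_finsetSum Finset.univ fun a _ =>
    tendsto_finsetSum Finset.univ fun b _ => (hφ a b).add (hψ a b))).add (hψM t ht)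
  simp only [add_zero, Finset.sum_const_zero] at hlim
  have h0 : eLpNorm (fun ω => M t ω - M' t ω) 2 P = 0 :=
    le_antisymm (ge_of_tendsto' hlim hle) zero_le
  filter_upwards [(eLpNorm_eq_zero_iff ((hM.measurable t ht).sub (hM'.measurable t ht))
    (by norm_num)).1 h0] with ω hω
  exact sub_eq_zero.1 hω

theorem IsWienerIntegral.eLpNorm_le [IsProbabilityMeasure P] (hW : IsWiener P W)
    (hσ : ∀ i j, AEStronglyMeasurable (fun t => σ t i j) (volume.restrict (Icc 0 T)))
    (hM : IsWienerIntegral P T σ W M) {t : ℝ} (ht : t ∈ Icc 0 T) :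
    eLpNorm (M t) 2 P
      ≤ ∑ a, ∑ b, eLpNorm (fun s => σ s a b) 2 (volume.restrict (Icc 0 T)) := by
  obtain ⟨φ, hφ, hφM⟩ := hM.limit
  have hI := fun χ : StepFn d => StepFn.aestronglyMeasurable_integral (P := P) hW.measurable χ t
  have hle : ∀ k, eLpNorm (M t) 2 P
      ≤ eLpNorm (fun ω => M t ω - (φ k).integral W t ω) 2 P
        + ∑ a, ∑ b, (eLpNorm (fun s => σ s a b) 2 (volume.restrict (Icc 0 T))
            + eLpNorm (fun s => σ s a b - (φ k).toFun s a b) 2 (volume.restrict (Icc 0 T))) := by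
    intro k
    -- Comparison with the zero integrand turns the estimate for differences of elementary integrals
    -- into one for a single integral.
    have h1 : M t = (fun ω => M t ω - (φ k).integral W t ω)
        + (fun ω => (φ k).integral W t ω - (StepFn.zero d).integral W t ω) := by
      ext1 ω; simp [StepFn.zero_integral]
    conv_lhs => rw [h1]
    refine (eLpNorm_add_le ((hM.measurable t ht).sub (hI _)) ((hI _).sub (hI _))
      (by norm_num)).trans (add_le_add_right ?_ _)
    refine (StepFn.eLpNorm_integral_sub_le hW (φ k) (StepFn.zero d) ht).trans
      (Finset.sum_le_sum fun a _ => Finset.sum_le_sum fun b _ => ?_)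
    have h2 : (fun s => (φ k).toFun s a b - (StepFn.zero d).toFun s a b)
        = (fun s => σ s a b) - (fun s => σ s a b - (φ k).toFun s a b) := by
      ext s; simp [StepFn.zero_toFun]
    rw [h2]
    exact eLpNorm_sub_le (hσ a b)
      ((hσ a b).sub ((φ k).measurable_toFun a b).aestronglyMeasurable) (by norm_num)
  have hlim := (hφM t ht).add (tendsto_finsetSum Finset.univ fun a _ =>
    tendsto_finsetSum Finset.univ fun b _ =>
      (tendsto_const_nhds (x := eLpNorm (fun s => σ s a b) 2 (volume.restrict (Icc 0 T)))).add
        (hφ a b))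
  simp only [add_zero, zero_add] at hlim
  exact ge_of_tendsto' hlim hle

/-- Elementary integrals up to `t` involve the noise only up to `t`, and a subsequence of them
converges almost surely. -/
theorem IsWienerIntegral.adapted (hW : IsWiener P W) (hM : IsWienerIntegral P T σ W M)
    (x₀ : Ω → Vec d) {t : ℝ} (ht : t ∈ Icc 0 T) : AEStronglyMeasurable[info x₀ W t] (M t) P := by
  obtain ⟨φ, -, hφM⟩ := hM.limit
  have hI := fun χ : StepFn d => StepFn.aestronglyMeasurable_integral (P := P) hW.measurable χ t
  have hlim : Tendsto (fun k => eLpNorm ((φ k).integral W t - M t) 2 P) atTop (𝓝 0) := by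
    refine (hφM t ht).congr fun k => ?_
    rw [← eLpNorm_neg]
    congr 1
    ext1 ω
    simp
  obtain ⟨ns, -, hns⟩ := (tendstoInMeasure_of_tendsto_eLpNorm (by norm_num) (fun k => hI (φ k))
    (hM.measurable t ht) hlim).exists_seq_tendsto_ae
  exact aestronglyMeasurable_of_forall_tendsto_ae
    (fun k => ((φ (ns k)).stronglyMeasurable_integral x₀ W t).aestronglyMeasurable) hns

end

/-! ### Coefficients as operators, and quadratic forms -/

section
variable {a b : ℕ} {T : ℝ} {M : ℝ → Matrix (Fin a) (Fin b) ℝ}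

/-- The expansion in matrix units transfers entrywise measurability and boundedness to the
operator-valued coefficient. -/
theorem mvL_eq_sum (M : Matrix (Fin a) (Fin b) ℝ) :
    mvL M = ∑ i, ∑ j, M i j • mvL (Matrix.single i j (1 : ℝ)) := by
  let F : Matrix (Fin a) (Fin b) ℝ →ₗ[ℝ] (Vec b →L[ℝ] Vec a) :=
    (LinearMap.toContinuousLinearMap (𝕜 := ℝ)).toLinearMap ∘ₗ (Matrix.toLpLin 2 2).toLinearMap
  have h : F M = ∑ i, ∑ j, M i j • F (Matrix.single i j (1 : ℝ)) := by
    conv_lhs => rw [Matrix.matrix_eq_sum_single M]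
    simp only [map_sum, ← map_smul, Matrix.smul_single, smul_eq_mul, mul_one]
  exact h

theorem IsBoundedCoeff.aestronglyMeasurable (hM : IsBoundedCoeff T M) :
    AEStronglyMeasurable (fun t => mvL (M t)) (volume.restrict (Icc 0 T)) := by
  simp only [fun t => mvL_eq_sum (M t)]
  exact Finset.aestronglyMeasurable_fun_sum _ fun i _ =>
    Finset.aestronglyMeasurable_fun_sum _ fun j _ =>
      (hM.measurable i j).aestronglyMeasurable.smul_const _

theorem IsBoundedCoeff.exists_norm_le (hM : IsBoundedCoeff T M) :
    ∃ K : ℝ, 0 ≤ K ∧ ∀ t ∈ Icc 0 T, ‖mvL (M t)‖ ≤ K := by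
  obtain ⟨K, hK⟩ := hM.bounded
  refine ⟨∑ i, ∑ j, |K| * ‖mvL (Matrix.single i j (1 : ℝ) : Matrix (Fin a) (Fin b) ℝ)‖,
    by positivity, fun t ht => ?_⟩
  rw [mvL_eq_sum]
  refine (norm_sum_le _ _).trans (Finset.sum_le_sum fun i _ => (norm_sum_le _ _).trans
    (Finset.sum_le_sum fun j _ => ?_))
  rw [norm_smul]
  exact mul_le_mul_of_nonneg_right ((hK t ht i j).trans (le_abs_self K)) (norm_nonneg _)

theorem quad_le (M : Matrix (Fin a) (Fin a) ℝ) (x : Vec a) : quad M x ≤ ‖mvL M‖ * ‖x‖ ^ 2 := by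
  refine (real_inner_le_norm _ _).trans ?_
  have := mul_le_mul_of_nonneg_left ((mvL M).le_opNorm x) (norm_nonneg x)
  rw [mvL_apply] at this
  linarith [this, sq (‖x‖)]

theorem quad_nonneg {M : Matrix (Fin a) (Fin a) ℝ} (hM : M.PosSemidef) (x : Vec a) :
    0 ≤ quad M x := by
  have h := hM.dotProduct_mulVec_nonneg x.ofLp
  simp only [quad, mv, EuclideanSpace.inner_eq_star_dotProduct]
  simpa [dotProduct_comm] using h

theorem quad_ge {M : Matrix (Fin a) (Fin a) ℝ} {δ : ℝ}
    (hM : (M - δ • (1 : Matrix (Fin a) (Fin a) ℝ)).PosSemidef) (x : Vec a) :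
    δ * ‖x‖ ^ 2 ≤ quad M x := by
  have h := quad_nonneg hM x
  have h2 : mv (M - δ • (1 : Matrix (Fin a) (Fin a) ℝ)) x = mv M x - δ • x := by
    ext i
    simp [mv, Matrix.sub_mulVec, Matrix.smul_mulVec]
  rw [quad, h2, inner_sub_right, inner_smul_right, real_inner_self_eq_norm_sq] at h
  rw [quad]
  linarith

end

/-! ### Pathwise and second-moment bounds for a state -/

section
variable {E : Type*} [NormedAddCommGroup E] [NormedSpace ℝ E]

/-- Grönwall's inequality for solutions of integral equations. -/
theorem norm_le_of_eq_add_integral {f w : ℝ → E} {r : ℝ → ℝ} {c : E} {K T : ℝ} (hK : 0 ≤ K)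
    (hT : 0 ≤ T) (hf : ContinuousOn f (Icc 0 T)) (hr : IntegrableOn r (Icc 0 T))
    (hr0 : ∀ s ∈ Icc 0 T, 0 ≤ r s) (hw : ∀ s ∈ Icc 0 T, ‖w s‖ ≤ r s + K * ‖f s‖)
    (h : ∀ t ∈ Icc 0 T, f t = c + ∫ s in (0 : ℝ)..t, w s) :
    ∀ t ∈ Icc 0 T, ‖f t‖ ≤ (‖c‖ + ∫ s in (0 : ℝ)..T, r s) * Real.exp (K * T) := by
  have hTT : T ∈ Icc 0 T := ⟨hT, le_rfl⟩
  have hfn : IntegrableOn (fun s => ‖f s‖) (Icc 0 T) :=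
    (hf.norm.integrableOn_compact isCompact_Icc)
  have hR0 : 0 ≤ ∫ s in (0 : ℝ)..T, r s := intervalIntegral.integral_nonneg hT hr0
  have key := le_mul_exp_of_le_add_integral (f := fun t => ‖f t‖)
    (c := ‖c‖ + ∫ s in (0 : ℝ)..T, r s) hK hT hf.norm (fun t ht => by
    have h1 : ‖∫ s in (0 : ℝ)..t, w s‖ ≤ ∫ s in (0 : ℝ)..t, (r s + K * ‖f s‖) :=
      intervalIntegral.norm_integral_le_of_norm_le ht.1
        (Eventually.of_forall fun s hs => hw s ⟨hs.1.le, hs.2.trans ht.2⟩)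
        ((intervalIntegrable_of_Icc ht hr).add ((intervalIntegrable_of_Icc ht hfn).const_mul K))
    rw [intervalIntegral.integral_add (intervalIntegrable_of_Icc ht hr)
      ((intervalIntegrable_of_Icc ht hfn).const_mul K), intervalIntegral.integral_const_mul] at h1
    have h2 : ∫ s in (0 : ℝ)..t, r s ≤ ∫ s in (0 : ℝ)..T, r s :=
      intervalIntegral.integral_mono_interval le_rfl ht.1 ht.2
        ((ae_restrict_mem measurableSet_Ioc).mono fun s hs => hr0 s (Ioc_subset_Icc_self hs))
        (intervalIntegrable_of_Icc hTT hr)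
    have h3 := norm_add_le c (∫ s in (0 : ℝ)..t, w s)
    rw [h t ht]
    linarith)
  intro t ht
  refine (key t ht).trans (mul_le_mul_of_nonneg_left ?_ (by positivity))
  exact Real.exp_le_exp.2 (mul_le_mul_of_nonneg_left ht.2 hK)

end

/-- The sum is at most twice the larger term. The constant `4` is not optimal, but the argument also
covers infinite values. -/
theorem add_sq_le_four_mul (a b : ℝ≥0∞) : (a + b) ^ 2 ≤ 4 * (a ^ 2 + b ^ 2) := by
  rcases le_total a b with h | h
  · calc (a + b) ^ 2 ≤ (b + b) ^ 2 := by gcongr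
      _ = 4 * (0 + b ^ 2) := by ring
      _ ≤ _ := by gcongr; exact zero_le
  · calc (a + b) ^ 2 ≤ (a + a) ^ 2 := by gcongr
      _ = 4 * (a ^ 2 + 0) := by ring
      _ ≤ _ := by gcongr; exact zero_le

theorem ofReal_intervalIntegral_norm_le {F : Type*} [NormedAddCommGroup F] {f : ℝ → F} {T : ℝ}
    (hT : 0 ≤ T) (hf : IntegrableOn f (Icc 0 T)) :
    ENNReal.ofReal (∫ s in (0 : ℝ)..T, ‖f s‖) = ∫⁻ s in Icc 0 T, ‖f s‖ₑ := by
  rw [intervalIntegral.integral_of_le hT, ← integral_Icc_eq_integral_Ioc,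
    ofReal_integral_norm_eq_lintegral_enorm hf]

section
variable {n m : ℕ} (D : Data n m)

/-- A common bound for the operator norms of the coefficients of the dynamics. -/
structure IsDynamicsBound (K : ℝ) : Prop where
  nonneg : 0 ≤ K
  A : ∀ t ∈ Icc 0 D.T, ‖mvL (D.A t)‖ ≤ K
  B : ∀ t ∈ Icc 0 D.T, ‖mvL (D.B t)‖ ≤ K
  Abar : ∀ t ∈ Icc 0 D.T, ‖mvL (D.Abar t)‖ ≤ K

theorem exists_isDynamicsBound : ∃ K, IsDynamicsBound D K := by
  obtain ⟨K₁, h₁, hA⟩ := D.A_bdd.exists_norm_le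
  obtain ⟨K₂, h₂, hB⟩ := D.B_bdd.exists_norm_le
  obtain ⟨K₃, h₃, hC⟩ := D.Abar_bdd.exists_norm_le
  exact ⟨K₁ + K₂ + K₃, by positivity, fun t ht => (hA t ht).trans (by linarith),
    fun t ht => (hB t ht).trans (by linarith), fun t ht => (hC t ht).trans (by linarith)⟩

variable {D} {K : ℝ}

/-- Pathwise bound for the state. -/
theorem IsDynamicsBound.norm_state_le (hK : IsDynamicsBound D K) {x M q : ℝ → Vec n}
    {v : ℝ → Vec m} {x₀ : Vec n} (hx : ContinuousOn x (Icc 0 D.T))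
    (hM : ContinuousOn M (Icc 0 D.T)) (hq : ContinuousOn q (Icc 0 D.T))
    (hv : IntegrableOn v (Icc 0 D.T))
    (h : ∀ t ∈ Icc 0 D.T, x t = x₀
      + (∫ s in (0 : ℝ)..t, (mv (D.A s) (x s) + mv (D.B s) (v s) + mv (D.Abar s) (q s))) + M t) :
    ∀ t ∈ Icc 0 D.T, ‖x t‖ₑ ≤ ‖M t‖ₑ + ENNReal.ofReal (Real.exp (K * D.T)) * (‖x₀‖ₑ +
      ENNReal.ofReal K * ((∫⁻ s in Icc 0 D.T, ‖M s‖ₑ) + ((∫⁻ s in Icc 0 D.T, ‖v s‖ₑ)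
        + ∫⁻ s in Icc 0 D.T, ‖q s‖ₑ))) := by
  have hT := D.T_pos.le
  have hTT : D.T ∈ Icc 0 D.T := ⟨hT, le_rfl⟩
  have hMi := hM.integrableOn_compact (μ := volume) isCompact_Icc
  have hqi := hq.integrableOn_compact (μ := volume) isCompact_Icc
  -- Subtracting the stochastic integral leaves `x - M`, which satisfies an integral equation
  -- without noise, so Grönwall applies path by path; `M` enters only as a source term.
  have key := norm_le_of_eq_add_integral (f := fun t => x t - M t) (c := x₀)
    (w := fun s => mv (D.A s) (x s) + mv (D.B s) (v s) + mv (D.Abar s) (q s))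
    (r := fun s => K * (‖M s‖ + (‖v s‖ + ‖q s‖))) hK.nonneg hT (hx.sub hM)
    ((hMi.norm.add (hv.norm.add hqi.norm)).const_mul K)
    (fun s _ => mul_nonneg hK.nonneg (by positivity))
    (fun s hs => by
      have h1 := (mvL (D.A s)).le_of_opNorm_le (hK.A s hs) (x s)
      have h2 := (mvL (D.B s)).le_of_opNorm_le (hK.B s hs) (v s)
      have h3 := (mvL (D.Abar s)).le_of_opNorm_le (hK.Abar s hs) (q s)
      rw [mvL_apply] at h1 h2 h3
      have h4 : K * ‖x s‖ ≤ K * (‖x s - M s‖ + ‖M s‖) :=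
        mul_le_mul_of_nonneg_left (by simpa using norm_add_le (x s - M s) (M s)) hK.nonneg
      refine (norm_add₃_le).trans ?_
      linarith)
    (fun t ht => by rw [h t ht]; abel)
  intro t ht
  have h1 : ‖x t‖ ≤ ‖M t‖ + Real.exp (K * D.T) * (‖x₀‖ + K * ((∫ s in (0 : ℝ)..D.T, ‖M s‖)
      + ((∫ s in (0 : ℝ)..D.T, ‖v s‖) + ∫ s in (0 : ℝ)..D.T, ‖q s‖))) := by
    have h2 := key t ht
    rw [intervalIntegral.integral_const_mul,
      intervalIntegral.integral_add (intervalIntegrable_of_Icc hTT hMi).norm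
        ((intervalIntegrable_of_Icc hTT hv).norm.add (intervalIntegrable_of_Icc hTT hqi).norm),
      intervalIntegral.integral_add (intervalIntegrable_of_Icc hTT hv).norm
        (intervalIntegrable_of_Icc hTT hqi).norm] at h2
    have h3 := norm_add_le (M t) (x t - M t)
    rw [add_sub_cancel] at h3
    linarith
  have hI : ∀ {F : Type} [NormedAddCommGroup F] (f : ℝ → F), 0 ≤ ∫ s in (0 : ℝ)..D.T, ‖f s‖ :=
    fun f => intervalIntegral.integral_nonneg hT fun _ _ => norm_nonneg _
  have hK0 := hK.nonneg
  have := hI M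
  have := hI v
  have := hI q
  rw [← ofReal_norm]
  refine (ENNReal.ofReal_le_ofReal h1).trans (le_of_eq ?_)
  rw [ENNReal.ofReal_add (by positivity) (by positivity), ENNReal.ofReal_mul (by positivity),
    ENNReal.ofReal_add (by positivity) (by positivity), ENNReal.ofReal_mul (by positivity),
    ENNReal.ofReal_add (by positivity) (by positivity),
    ENNReal.ofReal_add (by positivity) (by positivity),
    ofReal_intervalIntegral_norm_le hT hMi, ofReal_intervalIntegral_norm_le hT hv,
    ofReal_intervalIntegral_norm_le hT hqi, ofReal_norm, ofReal_norm]

end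

section
variable {Ω : Type*} [MeasurableSpace Ω] {P : Measure Ω} [IsProbabilityMeasure P] {m : ℕ} {T : ℝ}
  {F : ℝ → MeasurableSpace Ω} {v : ℝ → Ω → Vec m}

theorem IsAdmissible.ae_integrableOn (hv : IsAdmissible P T F v) :
    ∀ᵐ ω ∂P, IntegrableOn (fun s => v s ω) (Icc 0 T) :=
  (hv.memLp.integrable (by norm_num)).prod_left_ae

theorem IsAdmissible.lintegral_sq_le (hv : IsAdmissible P T F v) :
    ∫⁻ ω, (∫⁻ s in Icc 0 T, ‖v s ω‖ₑ) ^ 2 ∂P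
      ≤ ENNReal.ofReal T * ∫⁻ ω, (∫⁻ s in Icc 0 T, ‖v s ω‖ₑ ^ 2) ∂P := by
  rw [← lintegral_const_mul' _ _ ENNReal.ofReal_ne_top]
  refine lintegral_mono_ae ?_
  filter_upwards [hv.ae_integrableOn] with ω hω
  refine (sq_lintegral_le hω.1.enorm).trans ?_
  simp

end

section
variable {n m : ℕ} {D : Data n m} {Ω : Type*} [MeasurableSpace Ω] {P : Measure Ω}
  {x₀ : Ω → Vec n} {W : ℝ≥0 → Ω → Vec n} {z : ℝ → Vec n}

theorem isAdmissible_zero {T : ℝ} {F : ℝ → MeasurableSpace Ω} :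
    IsAdmissible P T F (fun _ _ => (0 : Vec m)) where
  memLp := MemLp.zero'
  adapted := fun _ _ => aestronglyMeasurable_const

/-- The integral up to `t` uses the previous iterate at times `s ≤ t` only, and the information
increases with time. -/
theorem aestronglyMeasurable_picard {L : ℝ → Vec n →L[ℝ] Vec n} {g : ℝ → Ω → Vec n} {T K : ℝ}
    (hL : AEStronglyMeasurable L (volume.restrict (Icc 0 T))) (hK : ∀ t ∈ Icc 0 T, ‖L t‖ ≤ K)
    (hgc : ∀ᵐ ω ∂P, ContinuousOn (fun t => g t ω) (Icc 0 T))
    (hg : ∀ t ∈ Icc 0 T, AEStronglyMeasurable[info x₀ W t] (g t) P) (k : ℕ) :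
    ∀ t ∈ Icc 0 T,
      AEStronglyMeasurable[info x₀ W t] (fun ω => picard L (fun s => g s ω) k t) P := by
  induction k with
  | zero => exact hg
  | succ k ih =>
    intro t ht
    have hsub : Icc 0 t ⊆ Icc 0 T := Icc_subset_Icc_right ht.2
    refine (hg t ht).add (aestronglyMeasurable_integral_clm
      (X := fun s ω => picard L (fun s => g s ω) k s)
      (hL.mono_measure (Measure.restrict_mono hsub le_rfl)) ht.1
      (fun s hs => (ih s (hsub hs)).mono (info_mono x₀ W hs.2)) ?_)
    filter_upwards [hgc] with ω hω
    exact (picard_continuousOn (ht.1.trans ht.2) hL hK hω k).mono hsub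

/-- The uncontrolled state equation has an adapted solution. -/
theorem exists_isState_zero (hW : IsWiener P W) {M : ℝ → Ω → Vec n}
    (hM : IsWienerIntegral P D.T D.σ W M) (hz : ContinuousOn z (Icc 0 D.T)) :
    ∃ x, IsState D P (info x₀ W) x₀ W (fun _ _ => (0 : Vec m)) (fun t _ => z t) x := by
  have hT := D.T_pos.le
  obtain ⟨K, hK⟩ := exists_isDynamicsBound D
  have hLm := D.A_bdd.aestronglyMeasurable
  have hzi : IntegrableOn (fun s => mvL (D.Abar s) (z s)) (Icc 0 D.T) :=
    integrableOn_clm_apply D.Abar_bdd.aestronglyMeasurable hK.Abar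
      (hz.integrableOn_compact isCompact_Icc)
  let g : ℝ → Ω → Vec n := fun t ω => x₀ ω + (∫ s in (0 : ℝ)..t, mvL (D.Abar s) (z s)) + M t ω
  have hgc : ∀ᵐ ω ∂P, ContinuousOn (fun t => g t ω) (Icc 0 D.T) := by
    filter_upwards [hM.continuous] with ω hω
    exact (continuousOn_const.add (continuousOn_primitive_Icc hT hzi)).add hω
  have hg : ∀ t ∈ Icc 0 D.T, AEStronglyMeasurable[info x₀ W t] (g t) P := fun t ht =>
    (((measurable_info_init x₀ W t).stronglyMeasurable.aestronglyMeasurable).add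
      aestronglyMeasurable_const).add (hM.adapted hW x₀ ht)
  have hlim : ∀ᵐ ω ∂P, ∃ x : ℝ → Vec n, ContinuousOn x (Icc 0 D.T) ∧
      (∀ t ∈ Icc 0 D.T, Tendsto (fun k => picard (fun s => mvL (D.A s)) (fun s => g s ω) k t)
        atTop (𝓝 (x t))) ∧
      ∀ t ∈ Icc 0 D.T, x t = g t ω + ∫ s in (0 : ℝ)..t, mvL (D.A s) (x s) := by
    filter_upwards [hgc] with ω hω
    exact exists_tendsto_picard hT hLm hK.A hω
  -- Defining the solution as the limit of the iterates, instead of choosing one for each path, lets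
  -- their adaptedness pass to it.
  let X : ℝ → Ω → Vec n := fun t ω =>
    limUnder atTop (fun k => picard (fun s => mvL (D.A s)) (fun s => g s ω) k t)
  refine ⟨X, fun t ht => ?_, ?_, M, hM, ?_⟩
  · refine aestronglyMeasurable_of_forall_tendsto_ae
      (fun k => aestronglyMeasurable_picard hLm hK.A hgc hg k t ht) ?_
    filter_upwards [hlim] with ω ⟨x, _, hx, _⟩
    exact tendsto_nhds_limUnder ⟨_, hx t ht⟩
  · filter_upwards [hlim] with ω ⟨x, hxc, hx, _⟩
    exact hxc.congr fun t ht => (hx t ht).limUnder_eq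
  · filter_upwards [hlim] with ω ⟨x, hxc, hx, hxe⟩ t ht
    have hX : ∀ t ∈ Icc 0 D.T, X t ω = x t := fun t ht => (hx t ht).limUnder_eq
    have hxi : IntegrableOn (fun s => mvL (D.A s) (x s)) (Icc 0 D.T) :=
      integrableOn_clm_apply hLm hK.A (hxc.integrableOn_compact isCompact_Icc)
    have h1 : ∫ s in (0 : ℝ)..t, (mv (D.A s) (X s ω) + mv (D.B s) 0 + mv (D.Abar s) (z s))
        = ∫ s in (0 : ℝ)..t, (mvL (D.A s) (x s) + mvL (D.Abar s) (z s)) :=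
      intervalIntegral_congr_Icc ht fun s hs => by
        rw [hX s hs, ← mvL_apply (D.B s), map_zero, add_zero]; rfl
    rw [hX t ht, hxe t ht, h1, intervalIntegral.integral_add (intervalIntegrable_of_Icc ht hxi)
      (intervalIntegrable_of_Icc ht hzi)]
    simp only [g]
    abel

theorem IsWienerIntegral.lintegral_sq_le [IsProbabilityMeasure P] (hW : IsWiener P W)
    {M : ℝ → Ω → Vec n} (hM : IsWienerIntegral P D.T D.σ W M) {t : ℝ} (ht : t ∈ Icc 0 D.T) :
    ∫⁻ ω, ‖M t ω‖ₑ ^ 2 ∂P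
      ≤ (∑ a, ∑ b, eLpNorm (fun s => D.σ s a b) 2 (volume.restrict (Icc 0 D.T))) ^ 2 := by
  have h := hM.eLpNorm_le hW (fun i j => (D.σ_memLp i j).1) ht
  have h2 : ∫⁻ ω, ‖M t ω‖ₑ ^ 2 ∂P = eLpNorm (M t) 2 P ^ 2 := by
    rw [eLpNorm_eq_lintegral_rpow_enorm_toReal (by norm_num) (by norm_num),
      ← ENNReal.rpow_natCast _ 2, ← ENNReal.rpow_mul]
    norm_num
  rw [h2]
  gcongr

/-- A bound for the second moments of a state, given bounds for the data. -/
noncomputable def momentBound (D : Data n m) (K : ℝ) (z : ℝ → Vec n) (V₀ Vv : ℝ≥0∞) : ℝ≥0∞ :=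
  let VM := (∑ a, ∑ b, eLpNorm (fun s => D.σ s a b) 2 (volume.restrict (Icc 0 D.T))) ^ 2
  4 * (VM + ENNReal.ofReal (Real.exp (K * D.T)) ^ 2 * (4 * (V₀ + ENNReal.ofReal K ^ 2 *
    (4 * (ENNReal.ofReal D.T ^ 2 * VM
      + 4 * (ENNReal.ofReal D.T * Vv + (∫⁻ s in Icc 0 D.T, ‖z s‖ₑ) ^ 2))))))

theorem momentBound_ne_top {K : ℝ} (hz : ContinuousOn z (Icc 0 D.T)) {V₀ Vv : ℝ≥0∞}
    (h₀ : V₀ ≠ ∞) (hv : Vv ≠ ∞) : momentBound D K z V₀ Vv ≠ ∞ := by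
  have h1 : ∑ a, ∑ b, eLpNorm (fun s => D.σ s a b) 2 (volume.restrict (Icc 0 D.T)) ≠ ∞ := by
    simp only [ne_eq, ENNReal.sum_eq_top, not_exists, not_and]
    exact fun a _ b _ => (D.σ_memLp a b).2.ne
  have h2 : ∫⁻ s in Icc 0 D.T, ‖z s‖ₑ ≠ ∞ :=
    (hz.integrableOn_compact (μ := volume) isCompact_Icc).2.ne
  unfold momentBound
  finiteness

/-- The second moment of a state. -/
theorem IsDynamicsBound.lintegral_sq_state_le [IsProbabilityMeasure P] {K : ℝ}
    (hK : IsDynamicsBound D K) (hW : IsWiener P W) (hx : Measurable x₀)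
    (hz : ContinuousOn z (Icc 0 D.T)) {F : ℝ → MeasurableSpace Ω} {v : ℝ → Ω → Vec m}
    {x : ℝ → Ω → Vec n} (hv : IsAdmissible P D.T F v)
    (hS : IsState D P F x₀ W v (fun t _ => z t) x) {t : ℝ} (ht : t ∈ Icc 0 D.T) :
    ∫⁻ ω, ‖x t ω‖ₑ ^ 2 ∂P ≤ momentBound D K z (∫⁻ ω, ‖x₀ ω‖ₑ ^ 2 ∂P)
      (∫⁻ ω, (∫⁻ s in Icc 0 D.T, ‖v s ω‖ₑ ^ 2) ∂P) := by
  obtain ⟨M, hM, heq⟩ := hS.equation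
  have hT := D.T_pos.le
  have hMa : AEMeasurable (fun ω => ∫⁻ s in Icc 0 D.T, ‖M s ω‖ₑ) P :=
    aemeasurable_lintegral_enorm hT hM.measurable hM.continuous
  set q := ∫⁻ s in Icc 0 D.T, ‖z s‖ₑ
  set e := ENNReal.ofReal (Real.exp (K * D.T))
  -- The nested factors `4` come from squaring the pathwise bound sum by sum, in the same nesting as
  -- `momentBound`.
  have hpt : ∀ᵐ ω ∂P, ‖x t ω‖ₑ ^ 2 ≤ 4 * (‖M t ω‖ₑ ^ 2 + e ^ 2 * (4 * (‖x₀ ω‖ₑ ^ 2 +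
      ENNReal.ofReal K ^ 2 * (4 * ((∫⁻ s in Icc 0 D.T, ‖M s ω‖ₑ) ^ 2 +
        4 * ((∫⁻ s in Icc 0 D.T, ‖v s ω‖ₑ) ^ 2 + q ^ 2)))))) := by
    filter_upwards [hS.continuous, hM.continuous, hv.ae_integrableOn, heq] with ω h1 h2 h3 h4
    refine (pow_le_pow_left' (hK.norm_state_le h1 h2 hz h3 h4 t ht) 2).trans ?_
    refine (add_sq_le_four_mul _ _).trans ?_
    rw [mul_pow]
    gcongr
    refine (add_sq_le_four_mul _ _).trans ?_
    rw [mul_pow]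
    gcongr
    refine (add_sq_le_four_mul _ _).trans ?_
    gcongr
    exact add_sq_le_four_mul _ _
  refine (lintegral_mono_ae hpt).trans ?_
  have e_ne : e ^ 2 ≠ ∞ := by finiteness
  have K_ne : ENNReal.ofReal K ^ 2 ≠ ∞ := by finiteness
  have four_ne : (4 : ℝ≥0∞) ≠ ∞ := by finiteness
  rw [lintegral_const_mul' _ _ four_ne,
    lintegral_add_left' ((hM.measurable t ht).enorm.pow_const 2), lintegral_const_mul' _ _ e_ne,
    lintegral_const_mul' _ _ four_ne, lintegral_add_left' (hx.enorm.pow_const 2).aemeasurable,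
    lintegral_const_mul' _ _ K_ne, lintegral_const_mul' _ _ four_ne,
    lintegral_add_left' (hMa.pow_const 2), lintegral_const_mul' _ _ four_ne,
    lintegral_add_right _ measurable_const, lintegral_const, measure_univ, mul_one]
  simp only [momentBound]
  have h1 := hM.lintegral_sq_le hW ht
  have h2 := lintegral_sq_lintegral_le hT hM.measurable hM.continuous
    fun s hs => hM.lintegral_sq_le hW hs
  have h3 := hv.lintegral_sq_le
  gcongr

end

/-! ### Cost estimates and moments of equilibrium trajectories -/

section
variable {n m : ℕ} {D : Data n m} {Ω : Type*} [MeasurableSpace Ω] {P : Measure Ω}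
  {z : ℝ → Vec n}

theorem ofReal_mul_norm_sq {c : ℝ} (hc : 0 ≤ c) {d : ℕ} (x : Vec d) :
    ENNReal.ofReal (c * ‖x‖ ^ 2) = ENNReal.ofReal c * ‖x‖ₑ ^ 2 := by
  rw [ENNReal.ofReal_mul hc, ENNReal.ofReal_pow (norm_nonneg _), ofReal_norm]

/-- The cost controls the energy of the control. -/
theorem le_cost (u : ℝ → Ω → Vec m) (y : ℝ → Ω → Vec n) :
    ENNReal.ofReal (D.δ / 2) * ∫⁻ ω, (∫⁻ t in Icc 0 D.T, ‖u t ω‖ₑ ^ 2) ∂P ≤ cost D P z u y := by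
  refine le_trans ?_ le_self_add
  rw [← lintegral_const_mul' _ _ ENNReal.ofReal_ne_top]
  refine lintegral_mono fun ω => ?_
  rw [← lintegral_const_mul' _ _ ENNReal.ofReal_ne_top]
  refine setLIntegral_mono' measurableSet_Icc fun t ht => ?_
  rw [← ofReal_mul_norm_sq (half_pos D.δ_pos).le]
  refine ENNReal.ofReal_le_ofReal ?_
  have h1 := quad_nonneg (D.Q_nonneg t ht) (y t ω)
  have h2 := quad_nonneg (D.Qbar_nonneg t ht) (y t ω - mv (D.S t) (z t))
  have h3 := quad_ge (D.R_ge t ht) (u t ω)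
  linarith

/-- Both the running and the terminal cost are quadratic in the state, with coefficients bounded on
all of `[0, T]` including the endpoint, so one constant serves both. The control term is left out
because it vanishes for the zero control. -/
theorem exists_quad_bound (hz : ContinuousOn z (Icc 0 D.T)) :
    ∃ c : ℝ, 0 ≤ c ∧ ∀ t ∈ Icc 0 D.T, ∀ x : Vec n,
      1 / 2 * (quad (D.Q t) x + quad (D.Qbar t) (x - mv (D.S t) (z t))) ≤ c * ‖x‖ ^ 2 + c := by
  obtain ⟨K₁, h₁, hQ⟩ := D.Q_bdd.exists_norm_le
  obtain ⟨K₂, h₂, hQb⟩ := D.Qbar_bdd.exists_norm_le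
  obtain ⟨K₃, h₃, hS⟩ := D.S_bdd.exists_norm_le
  obtain ⟨Z, hZ⟩ := isCompact_Icc.exists_bound_of_continuousOn hz
  refine ⟨K₁ + K₂ + K₂ * (K₃ * Z) ^ 2, by positivity, fun t ht x => ?_⟩
  have h1 : quad (D.Q t) x ≤ K₁ * ‖x‖ ^ 2 :=
    (quad_le _ _).trans (mul_le_mul_of_nonneg_right (hQ t ht) (sq_nonneg _))
  have h2 : quad (D.Qbar t) (x - mv (D.S t) (z t)) ≤ K₂ * ‖x - mv (D.S t) (z t)‖ ^ 2 :=
    (quad_le _ _).trans (mul_le_mul_of_nonneg_right (hQb t ht) (sq_nonneg _))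
  have h3 : ‖mv (D.S t) (z t)‖ ≤ K₃ * Z :=
    ((mvL (D.S t)).le_of_opNorm_le (hS t ht) (z t)).trans
      (mul_le_mul_of_nonneg_left (hZ t ht) h₃)
  have h4 : ‖x - mv (D.S t) (z t)‖ ^ 2 ≤ 2 * ‖x‖ ^ 2 + 2 * (K₃ * Z) ^ 2 := by
    have h5 : ‖x - mv (D.S t) (z t)‖ ≤ ‖x‖ + K₃ * Z := (norm_sub_le _ _).trans (by linarith)
    have h6 : ‖x - mv (D.S t) (z t)‖ ^ 2 ≤ (‖x‖ + K₃ * Z) ^ 2 :=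
      pow_le_pow_left₀ (norm_nonneg _) h5 2
    linarith [sq_nonneg (‖x‖ - K₃ * Z), add_sq ‖x‖ (K₃ * Z), sub_sq ‖x‖ (K₃ * Z)]
  have h7 := mul_le_mul_of_nonneg_left h4 h₂
  have h8 : 0 ≤ K₂ * (K₃ * Z) ^ 2 * ‖x‖ ^ 2 := by positivity
  have h9 : 0 ≤ K₁ * ‖x‖ ^ 2 := by positivity
  linarith

/-- The cost of the zero control is controlled by the second moments of the state. -/
theorem cost_zero_le [IsProbabilityMeasure P] {c : ℝ} (hc : 0 ≤ c)
    (hcz : ∀ t ∈ Icc 0 D.T, ∀ x : Vec n,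
      1 / 2 * (quad (D.Q t) x + quad (D.Qbar t) (x - mv (D.S t) (z t))) ≤ c * ‖x‖ ^ 2 + c)
    {x : ℝ → Ω → Vec n} (hx : ∀ s ∈ Icc 0 D.T, AEStronglyMeasurable (x s) P)
    (hxc : ∀ᵐ ω ∂P, ContinuousOn (fun s => x s ω) (Icc 0 D.T)) {V : ℝ≥0∞}
    (hV : ∀ t ∈ Icc 0 D.T, ∫⁻ ω, ‖x t ω‖ₑ ^ 2 ∂P ≤ V) :
    cost D P z (fun _ _ => (0 : Vec m)) x
      ≤ ENNReal.ofReal D.T * (ENNReal.ofReal c * V + ENNReal.ofReal c)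
        + (ENNReal.ofReal c * V + ENNReal.ofReal c) := by
  have hT := D.T_pos.le
  have hm : AEMeasurable (fun p : Ω × ℝ => ENNReal.ofReal c * ‖x p.2 p.1‖ₑ ^ 2 + ENNReal.ofReal c)
      (P.prod (volume.restrict (Icc 0 D.T))) :=
    (((aestronglyMeasurable_uncurry_swap hT hx hxc).enorm.pow_const 2).const_mul _).add aemeasurable_const
  have hpt : ∀ t ∈ Icc 0 D.T, ∀ y : Vec n, ENNReal.ofReal
      (1 / 2 * (quad (D.Q t) y + quad (D.Qbar t) (y - mv (D.S t) (z t))))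
      ≤ ENNReal.ofReal c * ‖y‖ₑ ^ 2 + ENNReal.ofReal c := fun t ht y => by
    rw [← ofReal_mul_norm_sq hc, ← ENNReal.ofReal_add (by positivity) hc]
    exact ENNReal.ofReal_le_ofReal (hcz t ht y)
  have hmom : ∀ t ∈ Icc 0 D.T, ∫⁻ ω, (ENNReal.ofReal c * ‖x t ω‖ₑ ^ 2 + ENNReal.ofReal c) ∂P
      ≤ ENNReal.ofReal c * V + ENNReal.ofReal c := fun t ht => by
    rw [lintegral_add_right _ measurable_const, lintegral_const_mul' _ _ ENNReal.ofReal_ne_top,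
      lintegral_const, measure_univ, mul_one]
    gcongr
    exact hV t ht
  refine add_le_add ?_ ?_
  · have h0 : ∀ t, quad (D.R t) (0 : Vec m) = 0 := fun t => by simp [quad]
    calc _ ≤ ∫⁻ ω, (∫⁻ t in Icc 0 D.T, (ENNReal.ofReal c * ‖x t ω‖ₑ ^ 2 + ENNReal.ofReal c)) ∂P := by
          refine lintegral_mono fun ω => setLIntegral_mono' measurableSet_Icc fun t ht => ?_
          rw [h0, add_zero]
          exact hpt t ht _
      _ = ∫⁻ t in Icc 0 D.T, (∫⁻ ω, (ENNReal.ofReal c * ‖x t ω‖ₑ ^ 2 + ENNReal.ofReal c) ∂P) :=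
          lintegral_lintegral_swap
            (f := fun ω t => ENNReal.ofReal c * ‖x t ω‖ₑ ^ 2 + ENNReal.ofReal c) hm
      _ ≤ ∫⁻ t in Icc 0 D.T, (ENNReal.ofReal c * V + ENNReal.ofReal c) :=
          setLIntegral_mono' measurableSet_Icc hmom
      _ = _ := by simp [mul_comm]
  · exact (lintegral_mono fun ω => hpt D.T ⟨hT, le_rfl⟩ _).trans (hmom D.T ⟨hT, le_rfl⟩)

end

/-- The second moments of equilibrium trajectories are bounded in terms of the data only. -/
theorem exists_equilibrium_moment_bound {n m : ℕ} (D : Data n m) (μ₀ : Measure (Vec n))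
    (hμ₀ : MemLp (fun x : Vec n => x) 2 μ₀) (z : ℝ → Vec n) (hz : ContinuousOn z (Icc 0 D.T)) :
    ∃ V : ℝ≥0, ∀ (Ω : Type*) [MeasurableSpace Ω] (P : Measure Ω) [IsProbabilityMeasure P]
      (x₀ : Ω → Vec n) (W : ℝ≥0 → Ω → Vec n) (u : ℝ → Ω → Vec m) (y : ℝ → Ω → Vec n),
      Measurable x₀ → P.map x₀ = μ₀ → IsWiener P W → IsMFGEquilibrium D P x₀ W z u y →
      ∀ t ∈ Icc 0 D.T, ∫⁻ ω, ‖y t ω‖ₑ ^ 2 ∂P ≤ V := by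
  obtain ⟨K, hK⟩ := exists_isDynamicsBound D
  obtain ⟨c, hc, hcz⟩ := exists_quad_bound (D := D) hz
  let V₀ : ℝ≥0∞ := ∫⁻ x, ‖x‖ₑ ^ 2 ∂μ₀
  have hV₀ : V₀ ≠ ∞ := by
    have h := hμ₀.2
    rw [eLpNorm_lt_top_iff_lintegral_rpow_enorm_lt_top (by norm_num) (by norm_num)] at h
    simpa [V₀] using h.ne
  -- `G` bounds the second moments of the zero-control trajectory, `J` its cost, and `U` the energy
  -- of an equilibrium control, through `δ/2 * energy ≤ cost ≤ J`.
  let G := momentBound D K z V₀ 0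
  have hG : G ≠ ∞ := momentBound_ne_top hz hV₀ ENNReal.zero_ne_top
  let J := ENNReal.ofReal D.T * (ENNReal.ofReal c * G + ENNReal.ofReal c)
        + (ENNReal.ofReal c * G + ENNReal.ofReal c)
  have hJ : J ≠ ∞ := by finiteness
  let U := (ENNReal.ofReal (D.δ / 2))⁻¹ * J
  have hδ : ENNReal.ofReal (D.δ / 2) ≠ 0 := (ENNReal.ofReal_pos.2 (half_pos D.δ_pos)).ne'
  have hU : U ≠ ∞ := ENNReal.mul_ne_top (ENNReal.inv_ne_top.2 hδ) hJ
  refine ⟨(momentBound D K z V₀ U).toNNReal, fun Ω _ P _ x₀ W u y hx hlaw hW hE t ht => ?_⟩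
  rw [ENNReal.coe_toNNReal (momentBound_ne_top hz hV₀ hU)]
  have hx₀ : ∫⁻ ω, ‖x₀ ω‖ₑ ^ 2 ∂P = V₀ := by
    simp only [V₀, ← hlaw]
    rw [lintegral_map (by fun_prop) hx]
  -- The stochastic integral is borrowed from the equilibrium state itself, so its existence need
  -- not be proved.
  obtain ⟨M, hM, -⟩ := hE.state.equation
  obtain ⟨x, hxS⟩ := exists_isState_zero (m := m) (x₀ := x₀) hW hM hz
  have hxm : ∀ s ∈ Icc 0 D.T, ∫⁻ ω, ‖x s ω‖ₑ ^ 2 ∂P ≤ G := fun s hs => by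
    have h := hK.lintegral_sq_state_le hW hx hz isAdmissible_zero hxS hs
    simpa [hx₀] using h
  have hcost : cost D P z u y ≤ J :=
    (hE.optimal _ x isAdmissible_zero hxS).trans (cost_zero_le hc hcz
      (fun s hs => (hxS.adapted s hs).mono (info_le hx hW.measurable s)) hxS.continuous hxm)
  have hu : ∫⁻ ω, (∫⁻ t in Icc 0 D.T, ‖u t ω‖ₑ ^ 2) ∂P ≤ U := by
    simp only [U]
    rw [← ENNReal.div_eq_inv_mul, ENNReal.le_div_iff_mul_le (Or.inl hδ)
      (Or.inl ENNReal.ofReal_ne_top), mul_comm]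
    exact (le_cost u y).trans hcost
  refine (hK.lintegral_sq_state_le hW hx hz hE.admissible hE.state ht).trans ?_
  rw [hx₀]
  simp only [momentBound]
  gcongr

/-! ### Independence of the players and Bienaymé's identity -/

section
variable {n : ℕ} {Ω : Type*} [MeasurableSpace Ω] {P : Measure Ω}

theorem enorm_sq_eq_sum (x : Vec n) : ‖x‖ₑ ^ 2 = ∑ c, ‖x c‖ₑ ^ 2 := by
  rw [← ofReal_norm, ← ENNReal.ofReal_pow (norm_nonneg _), EuclideanSpace.norm_sq_eq,
    ENNReal.ofReal_sum_of_nonneg fun _ _ => sq_nonneg _]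
  simp only [ENNReal.ofReal_pow (norm_nonneg _), ofReal_norm]

/-- Bienaymé's identity, as an upper bound for vector-valued random variables. -/
theorem lintegral_sq_sum_sub_le [IsProbabilityMeasure P] {ι : Type*} (s : Finset ι)
    {Y : ι → Ω → Vec n} {z : Vec n} (hY : ∀ i, MemLp (Y i) 2 P) (hz : ∀ i, ∫ ω, Y i ω ∂P = z)
    (hind : ∀ i j, i ≠ j → IndepFun (Y i) (Y j) P) :
    ∫⁻ ω, ‖∑ i ∈ s, (Y i ω - z)‖ₑ ^ 2 ∂P ≤ ∑ i ∈ s, ∫⁻ ω, ‖Y i ω‖ₑ ^ 2 ∂P := by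
  have hYc : ∀ i c, MemLp (fun ω => Y i ω c) 2 P := fun i c =>
    (EuclideanSpace.proj (𝕜 := ℝ) c).comp_memLp' (hY i)
  have hmean : ∀ i c, ∫ ω, Y i ω c ∂P = z c := fun i c => by
    rw [← hz i]
    exact (EuclideanSpace.proj (𝕜 := ℝ) c).integral_comp_comm ((hY i).integrable (by norm_num))
  have hsm : ∀ c, MemLp (fun ω => ∑ i ∈ s, Y i ω c) 2 P := fun c =>
    memLp_finsetSum s fun i _ => hYc i c
  have hcoord : ∀ c, ∫⁻ ω, ‖(∑ i ∈ s, (Y i ω - z)) c‖ₑ ^ 2 ∂P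
      ≤ ∑ i ∈ s, ∫⁻ ω, ‖Y i ω c‖ₑ ^ 2 ∂P := by
    intro c
    -- All the means equal `z`, so the centred coordinate sum has the variance of the coordinate sum
    -- as its second moment; pairwise independence makes this variance additive.
    have h1 : ∫⁻ ω, ‖(∑ i ∈ s, (Y i ω - z)) c‖ₑ ^ 2 ∂P
        = evariance (fun ω => ∑ i ∈ s, Y i ω c) P := by
      rw [evariance]
      rw [integral_finsetSum _ fun i _ => (hYc i c).integrable (by norm_num)]
      simp only [hmean, WithLp.ofLp_sum, Finset.sum_apply, PiLp.sub_apply, Finset.sum_sub_distrib]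
    have h2 : variance (fun ω => ∑ i ∈ s, Y i ω c) P = ∑ i ∈ s, variance (fun ω => Y i ω c) P := by
      have := IndepFun.variance_sum (X := fun i ω => Y i ω c) (s := s) (μ := P)
        (fun i _ => hYc i c) (fun i _ j _ hij => (hind i j hij).comp
          (φ := fun x : Vec n => x c) (ψ := fun x : Vec n => x c) (by fun_prop) (by fun_prop))
      rwa [Finset.sum_fn] at this
    rw [h1, ← (hsm c).ofReal_variance_eq, h2,
      ENNReal.ofReal_sum_of_nonneg fun _ _ => variance_nonneg _ _]
    refine Finset.sum_le_sum fun i _ => ?_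
    have h3 : variance (fun ω => Y i ω c) P ≤ ∫ ω, Y i ω c ^ 2 ∂P :=
      variance_le_expectation_sq (hYc i c).1
    refine (ENNReal.ofReal_le_ofReal h3).trans (le_of_eq ?_)
    rw [ofReal_integral_eq_lintegral_ofReal (hYc i c).integrable_sq
      (Eventually.of_forall fun ω => sq_nonneg _)]
    refine lintegral_congr fun ω => ?_
    rw [← sq_abs, ENNReal.ofReal_pow (abs_nonneg _), ← Real.norm_eq_abs, ofReal_norm]
  have hcm : ∀ i c, AEMeasurable (fun ω => ‖Y i ω c‖ₑ ^ 2) P := fun i c =>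
    (hYc i c).1.enorm.pow_const 2
  simp only [enorm_sq_eq_sum (∑ i ∈ s, _), enorm_sq_eq_sum (Y _ _)]
  rw [lintegral_finsetSum']
  · refine (Finset.sum_le_sum fun c _ => hcoord c).trans (le_of_eq ?_)
    rw [Finset.sum_comm]
    refine Finset.sum_congr rfl fun i _ => ?_
    rw [lintegral_finsetSum' _ fun c _ => hcm i c]
  · intro c _
    refine AEMeasurable.pow_const (AEStronglyMeasurable.enorm ?_) 2
    refine (EuclideanSpace.proj (𝕜 := ℝ) c).continuous.comp_aestronglyMeasurable
      (Finset.aestronglyMeasurable_fun_sum _ fun i _ => (hY i).1.sub aestronglyMeasurable_const)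

/-- Independence of the players is stated for initial states and whole noise paths; this inclusion
passes it to the information up to a given time. -/
theorem info_le_comap {Ω' : Type*} (x₀ : Ω' → Vec n) (W : ℝ≥0 → Ω' → Vec n) (t : ℝ) :
    info x₀ W t ≤ MeasurableSpace.comap (fun ω => (x₀ ω, fun s => W s ω)) inferInstance := by
  have h := comap_measurable (m := inferInstance) (fun ω => (x₀ ω, fun s => W s ω))
  refine sup_le (measurable_fst.comp h).comap_le (iSup₂_le fun s _ => ?_)
  exact ((measurable_pi_apply s).comp (measurable_snd.comp h)).comap_le

/-- Random variables that depend on the information of different players are independent. -/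
theorem IsPlayers.indepFun {N : ℕ} {μ₀ : Measure (Vec n)} {x₀ : Fin N → Ω → Vec n}
    {W : Fin N → ℝ≥0 → Ω → Vec n} (h : IsPlayers P μ₀ x₀ W) {Y : Fin N → Ω → Vec n} {t : ℝ}
    (hY : ∀ i, AEStronglyMeasurable[info (x₀ i) (W i) t] (Y i) P) (i j : Fin N) (hij : i ≠ j) :
    IndepFun (Y i) (Y j) P := by
  choose Z hZ hYZ using hY
  refine IndepFun.congr ?_ (hYZ i).symm (hYZ j).symm
  have h1 := (IndepFun_iff_Indep _ _ _).1 (h.indep.indepFun hij)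
  rw [IndepFun_iff_Indep]
  exact indep_of_indep_of_le_left (indep_of_indep_of_le_right h1
    ((hZ j).measurable.comap_le.trans (info_le_comap _ _ _)))
    ((hZ i).measurable.comap_le.trans (info_le_comap _ _ _))

end

/-! ### Stability of the coupled error system -/

section
variable {E : Type*} [NormedAddCommGroup E] [NormedSpace ℝ E] {N : ℕ}

/-- Stability of a linear system with mean field coupling: the size of the solution is controlled
by the individual perturbation and by the average of all perturbations. -/
theorem norm_coupled_le (hN : 2 ≤ N) {A Abar : ℝ → E →L[ℝ] E} {K T : ℝ} (hT : 0 ≤ T)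
    (hA : ∀ t ∈ Icc 0 T, ‖A t‖ ≤ K) (hAbar : ∀ t ∈ Icc 0 T, ‖Abar t‖ ≤ K)
    {e h : Fin N → ℝ → E} (he : ∀ i, ContinuousOn (e i) (Icc 0 T))
    (hh : ∀ i, ContinuousOn (h i) (Icc 0 T))
    (heq : ∀ i, ∀ t ∈ Icc 0 T, e i t = ∫ s in (0 : ℝ)..t, (A s (e i s) +
      Abar s (((N : ℝ) - 1)⁻¹ • ∑ j ∈ Finset.univ.erase i, e j s + h i s))) (i : Fin N) :
    ∀ t ∈ Icc 0 T, ‖e i t‖ ≤ K * Real.exp (K * T) * ((∫ s in (0 : ℝ)..T, ‖h i s‖) +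
      T * (K * Real.exp (2 * K * T)) *
        (((N : ℝ) - 1)⁻¹ * ∑ j, ∫ s in (0 : ℝ)..T, ‖h j s‖)) := by
  have hK0 : 0 ≤ K := (norm_nonneg _).trans (hA 0 ⟨le_rfl, hT⟩)
  have hTT : T ∈ Icc 0 T := ⟨hT, le_rfl⟩
  have hN1 : (0 : ℝ) < (N : ℝ) - 1 := by
    have : (2 : ℝ) ≤ N := by exact_mod_cast hN
    linarith
  have hei := fun i => (he i).norm.integrableOn_compact (μ := volume) isCompact_Icc
  have hhi := fun i => (hh i).norm.integrableOn_compact (μ := volume) isCompact_Icc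
  set R : Fin N → ℝ := fun j => ∫ s in (0 : ℝ)..T, ‖h j s‖ with hR
  have hR0 : ∀ j, 0 ≤ R j := fun j => intervalIntegral.integral_nonneg hT fun _ _ => norm_nonneg _
  set S : ℝ → ℝ := fun t => ∑ j, ‖e j t‖ with hS
  have hSc : ContinuousOn S (Icc 0 T) := continuousOn_finsetSum _ fun j _ => (he j).norm
  have hSi := hSc.integrableOn_compact (μ := volume) isCompact_Icc
  have hpt : ∀ i, ∀ s ∈ Icc 0 T, ‖A s (e i s) +
      Abar s (((N : ℝ) - 1)⁻¹ • ∑ j ∈ Finset.univ.erase i, e j s + h i s)‖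
      ≤ K * (((N : ℝ) - 1)⁻¹ * (S s - ‖e i s‖) + ‖h i s‖) + K * ‖e i s‖ := by
    intro i s hs
    have h1 := (A s).le_of_opNorm_le (hA s hs) (e i s)
    have h2 := (Abar s).le_of_opNorm_le (hAbar s hs)
      (((N : ℝ) - 1)⁻¹ • ∑ j ∈ Finset.univ.erase i, e j s + h i s)
    have h3 : ‖((N : ℝ) - 1)⁻¹ • ∑ j ∈ Finset.univ.erase i, e j s + h i s‖
        ≤ ((N : ℝ) - 1)⁻¹ * (S s - ‖e i s‖) + ‖h i s‖ := by
      refine (norm_add_le _ _).trans (add_le_add_left ?_ _)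
      rw [norm_smul, Real.norm_of_nonneg (inv_nonneg.2 hN1.le)]
      refine mul_le_mul_of_nonneg_left ((norm_sum_le _ _).trans (le_of_eq ?_))
        (inv_nonneg.2 hN1.le)
      rw [hS, ← Finset.sum_erase_eq_sub (Finset.mem_univ i)]
    have h4 := mul_le_mul_of_nonneg_left h3 hK0
    have h5 := norm_add_le (A s (e i s))
      (Abar s (((N : ℝ) - 1)⁻¹ • ∑ j ∈ Finset.univ.erase i, e j s + h i s))
    linarith
  have hgi : ∀ i, IntegrableOn
      (fun s => K * (((N : ℝ) - 1)⁻¹ * (S s - ‖e i s‖) + ‖h i s‖) + K * ‖e i s‖) (Icc 0 T) :=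
    fun i => ((((hSi.sub (hei i)).const_mul _).add (hhi i)).const_mul K).add
      ((hei i).const_mul K)
  -- Grönwall is first applied to the sum over all players, which closes on itself; afterwards the
  -- coupling is a known source in the equation of each player.
  have hSbound : ∀ t ∈ Icc 0 T, S t ≤ (K * ∑ j, R j) * Real.exp (2 * K * T) := by
    have hgr := le_mul_exp_of_le_add_integral (f := S) (c := K * ∑ j, R j) (K := 2 * K)
      (by positivity) hT hSc (fun t ht => by
      have h1 : ∀ i, ‖e i t‖ ≤ ∫ s in (0 : ℝ)..t,
          (K * (((N : ℝ) - 1)⁻¹ * (S s - ‖e i s‖) + ‖h i s‖) + K * ‖e i s‖) := by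
        intro i
        rw [heq i t ht]
        exact intervalIntegral.norm_integral_le_of_norm_le ht.1
          (Eventually.of_forall fun s hs => hpt i s ⟨hs.1.le, hs.2.trans ht.2⟩)
          (intervalIntegrable_of_Icc ht (hgi i))
      have h2 : S t ≤ ∫ s in (0 : ℝ)..t, (2 * K * S s + K * ∑ j, ‖h j s‖) := by
        refine (Finset.sum_le_sum fun i _ => h1 i).trans (le_of_eq ?_)
        rw [← intervalIntegral.integral_finsetSum fun i _ => intervalIntegrable_of_Icc ht (hgi i)]
        refine intervalIntegral.integral_congr fun s _ => ?_
        simp only [Finset.sum_add_distrib, ← Finset.mul_sum, Finset.sum_sub_distrib,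
          Finset.sum_const, Finset.card_univ, Fintype.card_fin, nsmul_eq_mul]
        -- Each `‖e j s‖` occurs in the averages of the `N - 1` other players, so the averages add
        -- up to exactly `S s`. This makes the rate `2 * K` independent of `N`.
        have h3 : ((N : ℝ) - 1)⁻¹ * (N * S s - ∑ i, ‖e i s‖) = S s := by
          change ((N : ℝ) - 1)⁻¹ * (N * S s - S s) = S s
          field_simp
        rw [h3]
        ring
      have hsum := fun t ht => intervalIntegrable_of_Icc (T := T) (t := t) ht
        (integrable_finsetSum Finset.univ fun j _ => hhi j)
      rw [intervalIntegral.integral_add ((intervalIntegrable_of_Icc ht hSi).const_mul _)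
        ((hsum t ht).const_mul K), intervalIntegral.integral_const_mul,
        intervalIntegral.integral_const_mul, intervalIntegral.integral_finsetSum
          fun j _ => intervalIntegrable_of_Icc ht (hhi j)] at h2
      have h4 : ∑ j, ∫ s in (0 : ℝ)..t, ‖h j s‖ ≤ ∑ j, R j := Finset.sum_le_sum fun j _ =>
        intervalIntegral.integral_mono_interval le_rfl ht.1 ht.2
          (Eventually.of_forall fun s => norm_nonneg _) (intervalIntegrable_of_Icc hTT (hhi j))
      have h5 := mul_le_mul_of_nonneg_left h4 hK0
      linarith)
    intro t ht
    refine (hgr t ht).trans (mul_le_mul_of_nonneg_left (Real.exp_le_exp.2 ?_)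
      (mul_nonneg hK0 (Finset.sum_nonneg fun j _ => hR0 j)))
    exact mul_le_mul_of_nonneg_left ht.2 (by positivity)
  set Sb : ℝ := (K * ∑ j, R j) * Real.exp (2 * K * T) with hSb
  have hSb0 : 0 ≤ Sb := mul_nonneg (mul_nonneg hK0 (Finset.sum_nonneg fun j _ => hR0 j))
    (Real.exp_pos _).le
  -- In the second Grönwall estimate `S s - ‖e i s‖` is replaced by the larger constant `Sb`.
  have key := norm_le_of_eq_add_integral (f := e i) (c := 0)
    (r := fun s => K * (((N : ℝ) - 1)⁻¹ * Sb + ‖h i s‖)) hK0 hT (he i)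
    (((integrableOn_const (by simp)).add (hhi i)).const_mul K)
    (fun s _ => by positivity)
    (fun s hs => (hpt i s hs).trans (add_le_add_left (mul_le_mul_of_nonneg_left
      (add_le_add_left (mul_le_mul_of_nonneg_left (by linarith [hSbound s hs, norm_nonneg (e i s)])
        (inv_nonneg.2 hN1.le)) _) hK0) _))
    (fun t ht => by rw [zero_add]; exact heq i t ht)
  intro t ht
  refine (key t ht).trans (le_of_eq ?_)
  rw [intervalIntegral.integral_const_mul, intervalIntegral.integral_add (by simp)
    (intervalIntegrable_of_Icc hTT (hhi i)), norm_zero]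
  simp only [intervalIntegral.integral_const, smul_eq_mul, sub_zero]
  rw [hSb]
  ring

end

/-- Cauchy–Schwarz for the counting measure on `Fin N`, whose total mass is `N`. -/
theorem sq_sum_le_card_mul {N : ℕ} (a : Fin N → ℝ≥0∞) : (∑ j, a j) ^ 2 ≤ N * ∑ j, a j ^ 2 := by
  have h := sq_lintegral_le (μ := Measure.count) (f := a) (by fun_prop)
  simpa [lintegral_fintype] using h

/-! ### Fluctuations of the empirical mean and the rate of convergence -/

section
variable {n m N : ℕ} {D : Data n m} {Ω : Type*} [MeasurableSpace Ω] {P : Measure Ω}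
  [IsProbabilityMeasure P] {μ₀ : Measure (Vec n)} {z : ℝ → Vec n} {x₀ : Fin N → Ω → Vec n}
  {W : Fin N → ℝ≥0 → Ω → Vec n} {u : Fin N → ℝ → Ω → Vec m} {yhat y : Fin N → ℝ → Ω → Vec n}

/-- The deviation of the empirical mean of the other equilibrium trajectories from its mean. -/
noncomputable def fluctuation (yhat : Fin N → ℝ → Ω → Vec n) (z : ℝ → Vec n) (i : Fin N) (t : ℝ)
    (ω : Ω) : Vec n :=
  ((N : ℝ) - 1)⁻¹ • ∑ j ∈ Finset.univ.erase i, (yhat j t ω - z t)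

theorem continuousOn_fluctuation {Ω' : Type*} {yhat : Fin N → ℝ → Ω' → Vec n} {ω : Ω'} {s : Set ℝ}
    (hy : ∀ j, ContinuousOn (fun t => yhat j t ω) s) (hz : ContinuousOn z s) (i : Fin N) :
    ContinuousOn (fun t => fluctuation yhat z i t ω) s := by
  unfold fluctuation
  fun_prop

theorem aestronglyMeasurable_fluctuation {Ω' : Type*} [MeasurableSpace Ω'] {P : Measure Ω'}
    {yhat : Fin N → ℝ → Ω' → Vec n} {t : ℝ} (hy : ∀ j, AEStronglyMeasurable (yhat j t) P)
    (i : Fin N) : AEStronglyMeasurable (fluctuation yhat z i t) P := by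
  unfold fluctuation
  fun_prop

/-- This is the source of the rate: by independence the centred sum has second moment at most `(N -
1) * V`, and the normalization contributes `(N - 1)⁻²`. -/
theorem lintegral_sq_fluctuation_le (hN : 2 ≤ N) (hp : IsPlayers P μ₀ x₀ W)
    (hE : ∀ i, IsMFGEquilibrium D P (x₀ i) (W i) z (u i) (yhat i)) {V : ℝ≥0} {t : ℝ}
    (ht : t ∈ Icc 0 D.T) (hV : ∀ i, ∫⁻ ω, ‖yhat i t ω‖ₑ ^ 2 ∂P ≤ V) (i : Fin N) :
    ∫⁻ ω, ‖fluctuation yhat z i t ω‖ₑ ^ 2 ∂P ≤ ENNReal.ofReal (V * ((N : ℝ) - 1)⁻¹) := by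
  have hN1 : (0 : ℝ) < (N : ℝ) - 1 := by
    have : (2 : ℝ) ≤ N := by exact_mod_cast hN
    linarith
  have hm : ∀ j, MemLp (yhat j t) 2 P := fun j => by
    refine ⟨((hE j).integrable t ht).1, ?_⟩
    rw [eLpNorm_lt_top_iff_lintegral_rpow_enorm_lt_top (by norm_num) (by norm_num)]
    simpa using (hV j).trans_lt ENNReal.coe_lt_top
  have h1 := lintegral_sq_sum_sub_le (Finset.univ.erase i) hm (fun j => ((hE j).mean t ht).symm)
    (hp.indepFun fun j => (hE j).state.adapted t ht)
  have h2 : ∑ j ∈ Finset.univ.erase i, ∫⁻ ω, ‖yhat j t ω‖ₑ ^ 2 ∂P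
      ≤ ENNReal.ofReal (((N : ℝ) - 1) * V) := by
    refine (Finset.sum_le_card_nsmul _ _ _ fun j _ => hV j).trans (le_of_eq ?_)
    rw [Finset.card_erase_of_mem (Finset.mem_univ i), Finset.card_univ, Fintype.card_fin,
      nsmul_eq_mul, ENNReal.ofReal_mul hN1.le, ENNReal.ofReal_coe_nnreal,
      ← ENNReal.ofReal_natCast, Nat.cast_sub (by lia), Nat.cast_one]
  simp only [fluctuation, enorm_smul, mul_pow]
  rw [lintegral_const_mul' _ _ (by finiteness)]
  refine (mul_le_mul_right (h1.trans h2) _).trans (le_of_eq ?_)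
  rw [Real.enorm_of_nonneg (inv_nonneg.2 hN1.le), ← ENNReal.ofReal_pow (inv_nonneg.2 hN1.le),
    ← ENNReal.ofReal_mul (by positivity)]
  congr 1
  field_simp

/-- Pathwise estimate of the deviation of the `N`-player system from the mean field limit. -/
theorem ae_enorm_sub_le (hN : 2 ≤ N) {K : ℝ} (hK : IsDynamicsBound D K)
    (hp : IsPlayers P μ₀ x₀ W)
    (hE : ∀ i, IsMFGEquilibrium D P (x₀ i) (W i) z (u i) (yhat i))
    (hS : ∀ i, IsState D P (jointInfo x₀ W) (x₀ i) (W i) (u i) (othersMean y i) (y i)) :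
    ∀ᵐ ω ∂P, ∀ i, ∀ t ∈ Icc 0 D.T, ‖y i t ω - yhat i t ω‖ₑ
      ≤ ENNReal.ofReal (K * Real.exp (K * D.T)) *
        ((∫⁻ s in Icc 0 D.T, ‖fluctuation yhat z i s ω‖ₑ) +
          ENNReal.ofReal (D.T * (K * Real.exp (2 * K * D.T)) * ((N : ℝ) - 1)⁻¹) *
            ∑ j, ∫⁻ s in Icc 0 D.T, ‖fluctuation yhat z j s ω‖ₑ) := by
  have hT := D.T_pos.le
  have hN1 : (0 : ℝ) < (N : ℝ) - 1 := by
    have : (2 : ℝ) ≤ N := by exact_mod_cast hN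
    linarith
  choose M hM hMeq using fun i => (hS i).equation
  choose M' hM' hMeq' using fun i => (hE i).state.equation
  -- The equality at each fixed time is upgraded to all times at once, since the estimate is
  -- pathwise on all of `[0, T]`.
  have hMM : ∀ i, ∀ᵐ ω ∂P, ∀ t ∈ Icc 0 D.T, M i t ω = M' i t ω := fun i =>
    indistinguishable_of_forall_ae_eq (hM i).continuous (hM' i).continuous fun t ht =>
      (hM i).ae_eq (hp.wiener i) (fun a b => (D.σ_memLp a b).1) (hM' i) ht
  filter_upwards [ae_all_iff.2 hMeq, ae_all_iff.2 hMeq', ae_all_iff.2 hMM,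
    ae_all_iff.2 fun i => (hS i).continuous, ae_all_iff.2 fun i => (hE i).state.continuous,
    ae_all_iff.2 fun i => (hE i).admissible.ae_integrableOn] with ω h1 h2 h3 h4 h5 h6 i t ht
  have hzc := (hE i).z_continuous
  have hfc : ∀ i, ContinuousOn (fun s => fluctuation yhat z i s ω) (Icc 0 D.T) := fun i =>
    continuousOn_fluctuation h5 hzc i
  have hoc : ∀ i, ContinuousOn (fun s => othersMean y i s ω) (Icc 0 D.T) := fun i =>
    by unfold othersMean; fun_prop
  have hint : ∀ {x q : ℝ → Vec n} {v : ℝ → Vec m}, ContinuousOn x (Icc 0 D.T) →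
      ContinuousOn q (Icc 0 D.T) → IntegrableOn v (Icc 0 D.T) →
      IntegrableOn (fun s => mv (D.A s) (x s) + mv (D.B s) (v s) + mv (D.Abar s) (q s))
        (Icc 0 D.T) := fun hx hq hv =>
    ((integrableOn_clm_apply D.A_bdd.aestronglyMeasurable hK.A
      (hx.integrableOn_compact isCompact_Icc)).add
      (integrableOn_clm_apply D.B_bdd.aestronglyMeasurable hK.B hv)).add
      (integrableOn_clm_apply D.Abar_bdd.aestronglyMeasurable hK.Abar
        (hq.integrableOn_compact isCompact_Icc))
  have key := norm_coupled_le hN hT hK.A hK.Abar (e := fun i s => y i s ω - yhat i s ω)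
    (h := fun i s => fluctuation yhat z i s ω) (fun i => (h4 i).sub (h5 i)) hfc
    (fun i t ht => by
      rw [h1 i t ht, h2 i t ht, h3 i t ht, add_sub_add_right_eq_sub, add_sub_add_left_eq_sub,
        ← intervalIntegral.integral_sub
          (intervalIntegrable_of_Icc ht (hint (h4 i) (hoc i) (h6 i)))
          (intervalIntegrable_of_Icc ht (hint (h5 i) hzc (h6 i)))]
      refine intervalIntegral.integral_congr fun s _ => ?_
      -- The coupling term splits into the average of the other players' errors and the fluctuation;
      -- there are exactly `N - 1` other players, so the copies of `z` average to `z`.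
      have hq : ((N : ℝ) - 1)⁻¹ • ∑ j ∈ Finset.univ.erase i, (y j s ω - yhat j s ω)
          + fluctuation yhat z i s ω = othersMean y i s ω - z s := by
        simp only [fluctuation, othersMean]
        rw [← smul_add, ← Finset.sum_add_distrib]
        simp only [sub_add_sub_cancel]
        rw [Finset.sum_sub_distrib, smul_sub, Finset.sum_const,
          Finset.card_erase_of_mem (Finset.mem_univ i), Finset.card_univ, Fintype.card_fin,
          ← Nat.cast_smul_eq_nsmul ℝ, Nat.cast_sub (by lia), Nat.cast_one, smul_smul,
          inv_mul_cancel₀ hN1.ne', one_smul]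
      simp only [hq, ← mvL_apply, map_sub]
      abel) i t ht
  have hK0 := hK.nonneg
  have hI : ∀ j, 0 ≤ ∫ s in (0 : ℝ)..D.T, ‖fluctuation yhat z j s ω‖ := fun j =>
    intervalIntegral.integral_nonneg hT fun _ _ => norm_nonneg _
  have hIE := fun j => ofReal_intervalIntegral_norm_le hT
    ((hfc j).integrableOn_compact (μ := volume) isCompact_Icc)
  have hsum0 := Finset.sum_nonneg fun j (_ : j ∈ Finset.univ) => hI j
  rw [← mul_assoc (D.T * _)] at key
  rw [← ofReal_norm]
  refine (ENNReal.ofReal_le_ofReal key).trans (le_of_eq ?_)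
  rw [ENNReal.ofReal_mul (by positivity), ENNReal.ofReal_add (hI i) (by positivity),
    ENNReal.ofReal_mul (p := D.T * _ * _) (by positivity),
    ENNReal.ofReal_sum_of_nonneg fun j _ => hI j]
  simp only [hIE]

end

theorem ofReal_sum_bound {c d B : ℝ} (hc : 0 ≤ c) (hd : 0 ≤ d) (hB : 0 ≤ B) (N : ℕ) :
    ENNReal.ofReal c ^ 2 * (4 * (ENNReal.ofReal B + ENNReal.ofReal d ^ 2 *
      (N * ∑ _j : Fin N, ENNReal.ofReal B)))
      = ENNReal.ofReal (c ^ 2 * (4 * (B + d ^ 2 * (N * (N * B))))) := by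
  rw [ENNReal.ofReal_mul (by positivity), ENNReal.ofReal_mul (by positivity),
    ENNReal.ofReal_add (by positivity) (by positivity), ENNReal.ofReal_mul (by positivity),
    ENNReal.ofReal_mul (by positivity), ENNReal.ofReal_mul (by positivity),
    ENNReal.ofReal_pow hc, ENNReal.ofReal_pow hd, ENNReal.ofReal_natCast]
  simp

end LQMFG

open LQMFG in
theorem proposition4p1 {n m : ℕ} (D : LQMFG.Data n m)
    (μ₀ : Measure (LQMFG.Vec n)) (hμ₀ : MemLp (fun x : LQMFG.Vec n => x) 2 μ₀)
    (z : ℝ → LQMFG.Vec n) :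
    ∃ C : ℝ, ∀ (N : ℕ), 2 ≤ N →
      ∀ (Ω : Type*) [MeasurableSpace Ω] (P : Measure Ω) [IsProbabilityMeasure P]
        (x₀ : Fin N → Ω → LQMFG.Vec n) (W : Fin N → ℝ≥0 → Ω → LQMFG.Vec n)
        (u : Fin N → ℝ → Ω → LQMFG.Vec m) (yhat y : Fin N → ℝ → Ω → LQMFG.Vec n),
        LQMFG.IsPlayers P μ₀ x₀ W →
        (∀ i, LQMFG.IsMFGEquilibrium D P (x₀ i) (W i) z (u i) (yhat i)) →
        (∀ i, LQMFG.IsState D P (LQMFG.jointInfo x₀ W) (x₀ i) (W i) (u i)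
          (LQMFG.othersMean y i) (y i)) →
        (⨆ i : Fin N, ∫⁻ ω, ⨆ t ∈ Icc 0 D.T, ‖y i t ω - yhat i t ω‖ₑ ^ 2 ∂P)
          ≤ ENNReal.ofReal (C / N) := by
  -- Continuity of `z` is part of being an equilibrium, so if it fails there are no equilibria and
  -- any constant will do.
  by_cases hz : ContinuousOn z (Icc 0 D.T)
  swap
  · exact ⟨0, fun N hN Ω _ P _ x₀ W u yhat y _ hE _ => absurd (hE ⟨0, by lia⟩).z_continuous hz⟩
  have hT := D.T_pos.le
  obtain ⟨K, hK⟩ := LQMFG.exists_isDynamicsBound D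
  obtain ⟨V, hV⟩ := LQMFG.exists_equilibrium_moment_bound D μ₀ hμ₀ z hz
  set c₁ : ℝ := K * Real.exp (K * D.T)
  set c₂ : ℝ := D.T * (K * Real.exp (2 * K * D.T))
  have hK0 := hK.nonneg
  have hc₁ : 0 ≤ c₁ := by positivity
  have hc₂ : 0 ≤ c₂ := by positivity
  -- The factor `8` is `4`, from squaring a sum, times `2`, from `(N - 1)⁻¹ ≤ 2 / N`; the inner `4`
  -- is the square of the bound `2` for `N / (N - 1)`.
  refine ⟨8 * c₁ ^ 2 * (1 + 4 * c₂ ^ 2) * (D.T ^ 2 * V),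
    fun N hN Ω _ P _ x₀ W u yhat y hp hE hS => iSup_le fun i => ?_⟩
  have hN2 : (2 : ℝ) ≤ N := by exact_mod_cast hN
  have hN1 : (0 : ℝ) < (N : ℝ) - 1 := by linarith
  have hmom : ∀ j, ∀ t ∈ Icc 0 D.T, ∫⁻ ω, ‖yhat j t ω‖ₑ ^ 2 ∂P ≤ V := fun j =>
    hV Ω P (x₀ j) (W j) (u j) (yhat j) (hp.measurable j) (hp.law j) (hp.wiener j) (hE j)
  have hfa : ∀ j, ∀ t ∈ Icc 0 D.T, AEStronglyMeasurable (fluctuation yhat z j t) P :=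
    fun j t ht => aestronglyMeasurable_fluctuation (fun l => ((hE l).integrable t ht).1) j
  have hfc : ∀ j, ∀ᵐ ω ∂P, ContinuousOn (fun s => fluctuation yhat z j s ω) (Icc 0 D.T) := by
    intro j
    filter_upwards [ae_all_iff.2 fun l => (hE l).state.continuous] with ω h
    exact continuousOn_fluctuation h hz j
  set R : Fin N → Ω → ℝ≥0∞ := fun j ω => ∫⁻ s in Icc 0 D.T, ‖fluctuation yhat z j s ω‖ₑ with hR
  have hRm : ∀ j, AEMeasurable (R j) P := fun j => aemeasurable_lintegral_enorm hT (hfa j) (hfc j)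
  set B : ℝ := D.T ^ 2 * (V * ((N : ℝ) - 1)⁻¹) with hB
  have hR2 : ∀ j, ∫⁻ ω, R j ω ^ 2 ∂P ≤ ENNReal.ofReal B := fun j => by
    rw [hB, ENNReal.ofReal_mul (by positivity), ENNReal.ofReal_pow hT]
    exact lintegral_sq_lintegral_le hT (hfa j) (hfc j)
      fun s hs => lintegral_sq_fluctuation_le hN hp hE hs (fun l => hmom l s hs) j
  -- The pathwise bound does not depend on `t`, so the supremum goes inside the expectation at no
  -- cost; no martingale inequality is needed because the noise has cancelled.
  have hpt : ∀ᵐ ω ∂P, ⨆ t ∈ Icc 0 D.T, ‖y i t ω - yhat i t ω‖ₑ ^ 2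
      ≤ ENNReal.ofReal c₁ ^ 2 * (4 * (R i ω ^ 2 +
        ENNReal.ofReal (c₂ * ((N : ℝ) - 1)⁻¹) ^ 2 * (N * ∑ j, R j ω ^ 2))) := by
    filter_upwards [ae_enorm_sub_le hN hK hp hE hS] with ω h
    refine iSup₂_le fun t ht => (pow_le_pow_left' (h i t ht) 2).trans ?_
    rw [mul_pow]
    gcongr
    refine (add_sq_le_four_mul _ _).trans ?_
    rw [mul_pow]
    gcongr
    exact sq_sum_le_card_mul _
  refine (lintegral_mono_ae hpt).trans ?_
  rw [lintegral_const_mul' _ _ (by finiteness), lintegral_const_mul' _ _ (by finiteness),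
    lintegral_add_left' ((hRm i).pow_const 2), lintegral_const_mul' _ _ (by finiteness),
    lintegral_const_mul' _ _ (by finiteness),
    lintegral_finsetSum' _ fun j _ => (hRm j).pow_const 2]
  have hB0 : 0 ≤ B := by positivity
  calc _ ≤ ENNReal.ofReal c₁ ^ 2 * (4 * (ENNReal.ofReal B +
        ENNReal.ofReal (c₂ * ((N : ℝ) - 1)⁻¹) ^ 2 * (N * ∑ j : Fin N, ENNReal.ofReal B))) := by
        gcongr with j
        · exact hR2 i
        · exact hR2 j
    _ = ENNReal.ofReal (c₁ ^ 2 * (4 * (B + (c₂ * ((N : ℝ) - 1)⁻¹) ^ 2 * (N * (N * B))))) := by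
        exact ofReal_sum_bound hc₁ (by positivity) hB0 N
    _ ≤ _ := by
        refine ENNReal.ofReal_le_ofReal ?_
        -- Here `N ≥ 2` enters, as `N ≤ 2 * (N - 1)`.
        have h1 : ((N : ℝ) - 1)⁻¹ ≤ 2 * (N : ℝ)⁻¹ := by
          rw [← div_eq_mul_inv, inv_le_comm₀ hN1 (by positivity), inv_div]
          linarith
        have h2 : ((N : ℝ) - 1)⁻¹ * N ≤ 2 := by
          calc _ ≤ 2 * (N : ℝ)⁻¹ * N := by gcongr
            _ = 2 := by field_simp
        have h3 : B ≤ D.T ^ 2 * (V * (2 * (N : ℝ)⁻¹)) := by rw [hB]; gcongr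
        calc _ = 4 * c₁ ^ 2 * (1 + c₂ ^ 2 * (((N : ℝ) - 1)⁻¹ * N) ^ 2) * B := by ring
          _ ≤ 4 * c₁ ^ 2 * (1 + c₂ ^ 2 * 2 ^ 2) * (D.T ^ 2 * (V * (2 * (N : ℝ)⁻¹))) := by
            gcongr
          _ = _ := by ring
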